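/- **Theorem (asymptotic validity of the sharded rank comparison test).** Let $V$ be a countable vocabulary and let examples be finite token sequences over $V$; $\mathrm{seq}(x_1,\dots,x_k)$ denotes the concatenation of the examples $x_1,\dots,x_k$. A model $\vartheta$ gives a token sequence $s$ the probability $p_\vartheta(s)$, where $\vartheta\mapsto p_\vartheta(s)$ is measurable for each $s$. Let $\theta$ be a random model and $X_1,X_2,\dots$ an i.i.d. sequence of random examples, and assume the null hypothesis $H_0$: $\theta$ is independent of $(X_i)_{i\ge1}$. *The test.* With $r$ shards and $m_r\ge 1$ permutations per shard, split the dataset $X_1,\dots,X_{n_r}$ into $r$ contiguous shards $S_1,\dots,S_r$, where $S_i$ has $k_i=\lfloor n_r/r\rfloor+1$ examples for $i\le n_r \bmod r$ and $k_i=\lfloor n_r/r\rfloor$ examples otherwise. For each shard draw permutations $\pi_{i,1},\dots,\pi_{i,m_r}$ uniformly from the symmetric group on $k_i$ letters, all draws being independent of each other and jointly independent of $(\theta,(X_l)_{l\ge1})$. Let $$s_i=\log p_\theta(\mathrm{seq}(S_i))-\frac1{m_r}\sum_{j=1}^{m_r}\log p_\theta(\mathrm{seq}(S_i^{\pi_{i,j}})),\qquad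 \bar s=\frac1r\sum_{i=1}^r s_i,\qquad \hat\sigma^2=\frac1{r-1}\sum_{i=1}^r(s_i-\bar s)^2,$$ where $S^{\pi}$ is $S$ with its examples reordered by $\pi$, and let $p^{(r)}=\Pr(t_{r-1}>\sqrt r\,\bar s/\hat\sigma)$ be the p-value of the one-sided t-test against $E[s_i]>0$, where $t_{r-1}$ has Student's t-distribution with $r-1$ degrees of freedom (the t-statistic is set to $0$ if $\hat\sigma=0$). *Assumptions.* (a) The shard sizes stay bounded: $\lfloor n_r/r\rfloor\le K$ for all $r$, for some constant $K$. (b) For every shard, $p_\theta(\mathrm{seq}(S_i))>0$ almost surely and $E\big[(\log p_\theta(\mathrm{seq}(S_i)))^2\big]<\infty$. (c) Non-degeneracy: for all large $r$, every shard $S_i$ and almost every value $\vartheta$ of $\theta$, with positive probability over the data there is a permutation $\sigma$ with $\log p_\vartheta(\mathrm{seq}(S_i^\sigma))\ne\log p_\vartheta(\mathrm{seq}(S_i))$. *Conclusion.* For every $\alpha\in(0,1)$, $$\big|P(p^{(r)}<\alpha)-\alpha\big|\longrightarrow 0\qquad\text{as } r\to\infty .$$ -/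

import Mathlib

open MeasureTheory ProbabilityTheory Filter Topology

noncomputable section

namespace ShardedTest

/-- Token sequences carry the discrete σ-algebra (the vocabulary is countable). -/
instance instMeasurableSpaceTokenSeq {V : Type*} : MeasurableSpace (List V) := ⊤

/-- Permutations of a finite index set carry the discrete σ-algebra. -/
instance instMeasurableSpacePerm {k : ℕ} : MeasurableSpace (Equiv.Perm (Fin k)) := ⊤

/-! ### Partition of `n` examples into `r` contiguous shards -/

/-- Number of examples in shard `i` (counted from `0`): `⌊n / r⌋`, plus one for the
first `n mod r` shards. -/
def shardSize (n r i : ℕ) : ℕ := n / r + if i < n % r then 1 else 0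

/-- Number of examples that precede shard `i`, i.e. `∑_{i' < i} shardSize n r i'`. -/
def shardStart (n r i : ℕ) : ℕ := ∑ i' ∈ Finset.range i, shardSize n r i'

theorem shardStart_eq (n r i : ℕ) : shardStart n r i = i * (n / r) + min i (n % r) := by
  induction i with
  | zero => simp [shardStart]
  | succ i ih =>
    have h : shardStart n r (i + 1) = shardStart n r i + shardSize n r i := by
      simp [shardStart, Finset.sum_range_succ]
    rw [h, ih, shardSize, Nat.succ_mul]
    split_ifs <;> omega

/-- The `r` shards together use up exactly the `n` examples. -/
theorem shardStart_self {n r : ℕ} (hr : 0 < r) : shardStart n r r = n := by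
  rw [shardStart_eq, min_eq_right (Nat.mod_lt n hr).le]
  exact Nat.div_add_mod n r

theorem shardStart_add_lt {n r : ℕ} (i : Fin r) (j : Fin (shardSize n r i)) :
    shardStart n r i + j < n := by
  have hr : 0 < r := i.pos
  have h1 : shardStart n r (i + 1) = shardStart n r i + shardSize n r i := by
    simp [shardStart, Finset.sum_range_succ]
  have h2 : shardStart n r (i + 1) ≤ shardStart n r r := by
    unfold shardStart
    exact Finset.sum_le_sum_of_subset (Finset.range_mono i.isLt)
  rw [shardStart_self hr] at h2
  have := j.isLt
  omega

/-- Shard `i` of the dataset `x = (x₁, …, xₙ)`: a block of adjacent examples. -/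
def shard {E : Type*} {n : ℕ} (r : ℕ) (x : Fin n → E) (i : Fin r) :
    Fin (shardSize n r i) → E :=
  fun j => x ⟨shardStart n r i + j, shardStart_add_lt i j⟩

/-! ### Shard statistics -/

/-- `seq`: concatenation of a finite family of examples (token sequences), in order. -/
def seq {V : Type*} {k : ℕ} (x : Fin k → List V) : List V := (List.ofFn x).flatten

/-- The log-likelihood `log p(seq(x₁, …, x_k))`, where `p s` is the probability that the
model gives to the token sequence `s`. -/
def logLik {V : Type*} (p : List V → ℝ) {k : ℕ} (x : Fin k → List V) : ℝ :=
  Real.log (p (seq x))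

/-- The shard statistic: log-likelihood of the canonical order minus the sample average of
the log-likelihoods of the orders given by the `m` permutations `π₁, …, π_m`. -/
def shardStat {V : Type*} (p : List V → ℝ) {k m : ℕ} (x : Fin k → List V)
    (π : Fin m → Equiv.Perm (Fin k)) : ℝ :=
  logLik p x - (∑ j, logLik p (x ∘ π j)) / m

/-! ### The one-sided one-sample t-test -/

/-- Density of Student's t-distribution with `ν` degrees of freedom. -/
def studentTPDF (ν x : ℝ) : ℝ :=
  Real.Gamma ((ν + 1) / 2) / (√(ν * Real.pi) * Real.Gamma (ν / 2)) *
    (1 + x ^ 2 / ν) ^ (-((ν + 1) / 2))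

def sampleMean {r : ℕ} (s : Fin r → ℝ) : ℝ := (∑ i, s i) / r

/-- The unbiased sample variance (denominator `r - 1`). -/
def sampleVariance {r : ℕ} (s : Fin r → ℝ) : ℝ :=
  (∑ i, (s i - sampleMean s) ^ 2) / ((r : ℝ) - 1)

/-- The t-statistic `s̄ / (σ̂ / √r)`; it has the value `0` when the sample variance is `0`. -/
def tStatistic {r : ℕ} (s : Fin r → ℝ) : ℝ :=
  sampleMean s / (√(sampleVariance s) / √(r : ℝ))

/-- p-value of the t-test against the one-sided alternative `E[s_i] > 0`: the upper tail
of the t-distribution with `r - 1` degrees of freedom beyond the t-statistic. -/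
def tTestPValue {r : ℕ} (s : Fin r → ℝ) : ℝ :=
  ∫ x in Set.Ioi (tStatistic s), studentTPDF ((r : ℝ) - 1) x

/-- The p-value returned by the sharded rank comparison test with `r` shards and `m`
permutations per shard, on the dataset `x`, for the model `p`, when the `j`-th permutation
drawn for shard `i` is `π i j`. -/
def shardedPValue {V : Type*} (p : List V → ℝ) {n r m : ℕ} (x : Fin n → List V)
    (π : (i : Fin r) → Fin m → Equiv.Perm (Fin (shardSize n r i))) : ℝ :=
  tTestPValue fun i => shardStat p (shard r x i) (π i)

end ShardedTest

end

open ShardedTest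

open MeasureTheory ProbabilityTheory Filter Topology

namespace ShardedTest

/-! ### Tails of Student's t-distribution converge to Gaussian tails -/

/-! Under the null hypothesis the model is independent of the data and the permutations together, so
the rejection probability is an average, over the law of the model, of rejection probabilities for a
frozen model (`measure_eq_lintegral_of_indepFun`). Dominated convergence then reduces the claim to
almost every fixed model.

For a fixed model the shards are independent and each has an exchangeable law. A uniformly reordered
shard has the same law as the shard itself, so every shard statistic is centered. The statistics
need not be identically distributed, since shard sizes and `m r` vary with `r`; they form a
triangular array (`isCenteredArray_shardStat`). Two estimates make it uniform, and both depend on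
the shard size only, of which there are finitely many. The statistic is dominated by `permBound`, a
square-integrable function of the shard alone, which gives uniform integrability of squares. Its
conditional mean given the shard is the deviation of the log-likelihood from its average over all
reorderings, whose second moment is positive by non-degeneracy and bounds the variance below for
every `m`.

For such arrays a Lindeberg argument gives the central limit theorem, truncation gives a law of
large numbers for the sample variance, and Slutsky's theorem makes the t-statistic asymptotically
Gaussian. Student tails converge to Gaussian tails, so comparing the p-value with `α` amounts in the
limit to comparing the t-statistic with a Gaussian quantile. -/

/-- Log-convexity of Gamma at the midpoint of `x` and `x + 1`, combined with the functional
equation. -/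
theorem gamma_add_half_le {x : ℝ} (hx : 0 < x) :
    Real.Gamma (x + 1 / 2) ≤ √x * Real.Gamma x := by
  have h := Real.Gamma_mul_add_mul_le_rpow_Gamma_mul_rpow_Gamma hx (by linarith : 0 < x + 1)
    (by norm_num : (0 : ℝ) < 1 / 2) (by norm_num : (0 : ℝ) < 1 / 2) (by norm_num)
  have hG := Real.Gamma_pos_of_pos hx
  rw [Real.Gamma_add_one hx.ne', ← Real.sqrt_eq_rpow, ← Real.sqrt_eq_rpow,
    Real.sqrt_mul hx.le] at h
  calc Real.Gamma (x + 1 / 2) = Real.Gamma (1 / 2 * x + 1 / 2 * (x + 1)) := by ring_nf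
    _ ≤ _ := h
    _ = √x * (√(Real.Gamma x) * √(Real.Gamma x)) := by ring
    _ = _ := by rw [Real.mul_self_sqrt hG.le]

theorem tendsto_gamma_add_half_div :
    Tendsto (fun x : ℝ => Real.Gamma (x + 1 / 2) / (√x * Real.Gamma x)) atTop (𝓝 1) := by
  have hlim : Tendsto (fun x : ℝ => √(1 - 1 / 2 * (x + 1 / 2)⁻¹)) atTop (𝓝 1) := by
    have : Tendsto (fun x : ℝ => (x + 1 / 2)⁻¹) atTop (𝓝 0) :=
      tendsto_inv_atTop_zero.comp (tendsto_atTop_add_const_right _ _ tendsto_id)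
    have h2 := ((this.const_mul (1 / 2)).const_sub 1).sqrt
    simpa using h2
  refine tendsto_of_tendsto_of_tendsto_of_le_of_le' hlim tendsto_const_nhds ?_ ?_
  · filter_upwards [eventually_gt_atTop 0] with x hx
    have hG := Real.Gamma_pos_of_pos hx
    have hG' := Real.Gamma_pos_of_pos (by linarith : 0 < x + 1 / 2)
    -- The same inequality shifted by one half bounds the ratio from below by `√(x / (x + 1 / 2))`.
    have h := gamma_add_half_le (by linarith : 0 < x + 1 / 2)
    rw [add_assoc, add_halves, Real.Gamma_add_one hx.ne'] at h
    have e : 1 - 1 / 2 * (x + 1 / 2)⁻¹ = x / (x + 1 / 2) := by field_simp; ring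
    have hs : 0 < √x := Real.sqrt_pos.2 hx
    have hs' : 0 < √(x + 1 / 2) := Real.sqrt_pos.2 (by linarith)
    rw [e, Real.sqrt_div hx.le, div_le_div_iff₀ hs' (by positivity)]
    calc √x * (√x * Real.Gamma x) = x * Real.Gamma x := by
          rw [← mul_assoc, Real.mul_self_sqrt hx.le]
      _ ≤ _ := h
      _ = _ := by ring
  · filter_upwards [eventually_gt_atTop 0] with x hx
    have hG := Real.Gamma_pos_of_pos hx
    exact div_le_one_of_le₀ (gamma_add_half_le hx) (by positivity)

theorem tendsto_studentTPDF_const :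
    Tendsto (fun ν : ℝ => Real.Gamma ((ν + 1) / 2) / (√(ν * Real.pi) * Real.Gamma (ν / 2)))
      atTop (𝓝 (√(2 * Real.pi))⁻¹) := by
  have h := (tendsto_gamma_add_half_div.comp
    (tendsto_id.atTop_div_const (by norm_num : (0 : ℝ) < 2))).mul_const (√(2 * Real.pi))⁻¹
  rw [one_mul] at h
  refine h.congr' ?_
  filter_upwards [eventually_gt_atTop 0] with ν hν
  have e : ν * Real.pi = ν / 2 * (2 * Real.pi) := by ring
  simp only [Function.comp, id]
  rw [e, Real.sqrt_mul (by positivity) (2 * Real.pi), ← add_div, div_mul_eq_mul_div,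
    div_eq_div_iff]
  · have : √(2 * Real.pi) ≠ 0 := by positivity
    field_simp
  · have := Real.Gamma_pos_of_pos (half_pos hν)
    positivity
  · have := Real.Gamma_pos_of_pos (half_pos hν)
    positivity

/-- The exponent `-(ν + 1) / 2` splits into `ν * (-1 / 2)`, which produces the exponential, and `-1
/ 2`, whose factor tends to `1`. -/
theorem tendsto_studentTPDF (x : ℝ) :
    Tendsto (fun ν : ℝ => studentTPDF ν x) atTop (𝓝 (gaussianPDFReal 0 1 x)) := by
  have hbase : Tendsto (fun ν : ℝ => 1 + x ^ 2 / ν) atTop (𝓝 1) := by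
    simpa using (tendsto_id.const_div_atTop (x ^ 2)).const_add 1
  have h1 : Tendsto (fun ν : ℝ => ((1 + x ^ 2 / ν) ^ ν) ^ (-(1 / 2) : ℝ)) atTop
      (𝓝 (Real.exp (x ^ 2) ^ (-(1 / 2) : ℝ))) :=
    (Real.tendsto_one_add_div_rpow_exp (x ^ 2)).rpow_const (Or.inl (Real.exp_pos _).ne')
  have h2 : Tendsto (fun ν : ℝ => (1 + x ^ 2 / ν) ^ (-(1 / 2) : ℝ)) atTop (𝓝 1) := by
    simpa using hbase.rpow_const (p := (-(1 / 2) : ℝ)) (Or.inl one_ne_zero)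
  have h3 := tendsto_studentTPDF_const.mul (h1.mul h2)
  rw [mul_one, ← Real.exp_mul] at h3
  have e : gaussianPDFReal 0 1 x = (√(2 * Real.pi))⁻¹ * Real.exp (x ^ 2 * -(1 / 2)) := by
    simp only [gaussianPDFReal, NNReal.coe_one, mul_one, sub_zero]
    congr 2
    ring
  rw [e]
  refine h3.congr' ?_
  filter_upwards [eventually_gt_atTop 0] with ν hν
  have hpos : 0 < 1 + x ^ 2 / ν := by positivity
  rw [studentTPDF, ← Real.rpow_mul hpos.le, ← Real.rpow_add hpos]
  congr 2
  ring

theorem studentTPDF_nonneg {ν : ℝ} (hν : 0 < ν) (x : ℝ) : 0 ≤ studentTPDF ν x := by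
  have h1 := Real.Gamma_pos_of_pos (half_pos hν)
  have h2 := Real.Gamma_pos_of_pos (by linarith : 0 < (ν + 1) / 2)
  unfold studentTPDF
  positivity

/-- Bernoulli's inequality with exponent `ν / 2 ≥ 1` removes `ν` from the kernel. As the normalizing
constants converge, this supplies an integrable majorant for dominated convergence. -/
theorem studentTPDF_le {ν : ℝ} (hν : 2 ≤ ν) (x : ℝ) :
    studentTPDF ν x ≤ Real.Gamma ((ν + 1) / 2) / (√(ν * Real.pi) * Real.Gamma (ν / 2)) *
      (1 + x ^ 2 / 2)⁻¹ := by
  have h1 := Real.Gamma_pos_of_pos (by linarith : 0 < ν / 2)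
  have h2 := Real.Gamma_pos_of_pos (by linarith : 0 < (ν + 1) / 2)
  have hν0 : 0 < ν := by linarith
  have hq : 0 ≤ x ^ 2 / ν := by positivity
  unfold studentTPDF
  gcongr
  rw [Real.rpow_neg (by positivity)]
  gcongr
  calc 1 + x ^ 2 / 2 = 1 + ν / 2 * (x ^ 2 / ν) := by field_simp
    _ ≤ (1 + x ^ 2 / ν) ^ (ν / 2) :=
      one_add_mul_self_le_rpow_one_add (by linarith) (by linarith)
    _ ≤ (1 + x ^ 2 / ν) ^ ((ν + 1) / 2) :=
      Real.rpow_le_rpow_of_exponent_le (by linarith) (by linarith)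

theorem measurable_studentTPDF (ν : ℝ) : Measurable (studentTPDF ν) := by
  unfold studentTPDF
  fun_prop

theorem integrable_inv_one_add_sq_div_two : Integrable fun x : ℝ => (1 + x ^ 2 / 2)⁻¹ := by
  have h := integrable_inv_one_add_sq.comp_div (by positivity : √2 ≠ 0)
  refine h.congr (ae_of_all _ fun x => ?_)
  simp [div_pow]

theorem integrable_studentTPDF {ν : ℝ} (hν : 2 ≤ ν) : Integrable (studentTPDF ν) := by
  refine (integrable_inv_one_add_sq_div_two.const_mul
    (Real.Gamma ((ν + 1) / 2) / (√(ν * Real.pi) * Real.Gamma (ν / 2)))).mono'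
    (measurable_studentTPDF ν).aestronglyMeasurable (ae_of_all _ fun x => ?_)
  rw [Real.norm_of_nonneg (studentTPDF_nonneg (by linarith) x)]
  exact studentTPDF_le hν x

/-- The upper tail function of Student's t-distribution is antitone. -/
theorem antitone_studentTail {ν : ℝ} (hν : 2 ≤ ν) :
    Antitone fun x => ∫ y in Set.Ioi x, studentTPDF ν y := fun _ _ hxy =>
  setIntegral_mono_set (integrable_studentTPDF hν).integrableOn
    (ae_of_all _ fun y => studentTPDF_nonneg (by linarith) y)
    (Set.Ioi_subset_Ioi hxy).eventuallyLE

/-- As the number of degrees of freedom grows, the upper tails of Student's t-distribution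
converge to those of the standard Gaussian distribution. -/
theorem tendsto_studentTail (x : ℝ) :
    Tendsto (fun r : ℕ => ∫ y in Set.Ioi x, studentTPDF ((r : ℝ) - 1) y) atTop
      (𝓝 ((gaussianReal 0 1).real (Set.Ioi x))) := by
  have hν : Tendsto (fun r : ℕ => (r : ℝ) - 1) atTop atTop :=
    tendsto_atTop_add_const_right _ _ tendsto_natCast_atTop_atTop
  have hG : (gaussianReal 0 1).real (Set.Ioi x) = ∫ y in Set.Ioi x, gaussianPDFReal 0 1 y := by
    rw [measureReal_def, gaussianReal_apply_eq_integral 0 one_ne_zero,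
      ENNReal.toReal_ofReal (integral_nonneg fun y => gaussianPDFReal_nonneg 0 1 y)]
  rw [hG]
  refine tendsto_integral_filter_of_dominated_convergence
    (fun y => ((√(2 * Real.pi))⁻¹ + 1) * (1 + y ^ 2 / 2)⁻¹) ?_ ?_ ?_ ?_
  · exact Eventually.of_forall fun r => (measurable_studentTPDF _).aestronglyMeasurable
  · filter_upwards [hν.eventually_ge_atTop 2,
      (tendsto_studentTPDF_const.comp hν).eventually_le_const
        (lt_add_one (√(2 * Real.pi))⁻¹)] with r hr hc
    refine ae_of_all _ fun y => ?_
    rw [Real.norm_of_nonneg (studentTPDF_nonneg (by linarith) y)]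
    exact (studentTPDF_le hr y).trans (mul_le_mul_of_nonneg_right hc (by positivity))
  · exact (integrable_inv_one_add_sq_div_two.const_mul _).integrableOn
  · exact ae_of_all _ fun y => (tendsto_studentTPDF y).comp hν

/-! ### Truncation of squares -/

/-- `x ^ 2` where `|x|` exceeds `M`, and `0` elsewhere. -/
noncomputable def sqTail (M x : ℝ) : ℝ := if M < |x| then x ^ 2 else 0

/-- `x ^ 2` where `|x|` is at most `M`, and `0` elsewhere. -/
noncomputable def sqTrunc (M x : ℝ) : ℝ := if M < |x| then 0 else x ^ 2

theorem sqTrunc_add_sqTail (M x : ℝ) : sqTrunc M x + sqTail M x = x ^ 2 := by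
  unfold sqTrunc sqTail; split_ifs <;> simp

theorem sqTail_nonneg (M x : ℝ) : 0 ≤ sqTail M x := by
  unfold sqTail; split_ifs <;> positivity

theorem sqTail_le_sq (M x : ℝ) : sqTail M x ≤ x ^ 2 := by
  unfold sqTail; split_ifs
  · exact le_rfl
  · positivity

theorem sqTrunc_nonneg (M x : ℝ) : 0 ≤ sqTrunc M x := by
  unfold sqTrunc; split_ifs <;> positivity

theorem sqTrunc_le (M x : ℝ) : sqTrunc M x ≤ M ^ 2 := by
  unfold sqTrunc; split_ifs with h
  · positivity
  · rw [← sq_abs x]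
    exact pow_le_pow_left₀ (abs_nonneg x) (not_lt.1 h) 2

theorem measurable_sqTail (M : ℝ) : Measurable (sqTail M) :=
  Measurable.ite (measurableSet_lt measurable_const measurable_norm) (by fun_prop)
    measurable_const

theorem measurable_sqTrunc (M : ℝ) : Measurable (sqTrunc M) :=
  Measurable.ite (measurableSet_lt measurable_const measurable_norm) measurable_const
    (by fun_prop)

/-! ### Characteristic functions -/

/-- Telescoping: factors are exchanged one at a time, and all the others have norm at most one. -/
theorem norm_prod_sub_prod_le_sum {ι : Type*} (t : Finset ι) (a b : ι → ℂ)
    (ha : ∀ i, ‖a i‖ ≤ 1) (hb : ∀ i, ‖b i‖ ≤ 1) :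
    ‖∏ i ∈ t, a i - ∏ i ∈ t, b i‖ ≤ ∑ i ∈ t, ‖a i - b i‖ := by
  classical
  induction t using Finset.induction_on with
  | empty => simp
  | insert i t hi ih =>
    rw [Finset.prod_insert hi, Finset.prod_insert hi, Finset.sum_insert hi]
    have hbt : ‖∏ j ∈ t, b j‖ ≤ 1 := by
      rw [norm_prod]
      exact Finset.prod_le_one (fun _ _ => norm_nonneg _) fun j _ => hb j
    calc ‖a i * ∏ j ∈ t, a j - b i * ∏ j ∈ t, b j‖
        = ‖(a i - b i) * ∏ j ∈ t, b j + a i * (∏ j ∈ t, a j - ∏ j ∈ t, b j)‖ := by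
          congr 1; ring
      _ ≤ ‖a i - b i‖ * ‖∏ j ∈ t, b j‖ + ‖a i‖ * ‖∏ j ∈ t, a j - ∏ j ∈ t, b j‖ := by
          rw [← norm_mul, ← norm_mul]; exact norm_add_le _ _
      _ ≤ ‖a i - b i‖ * 1 + 1 * ‖∏ j ∈ t, a j - ∏ j ∈ t, b j‖ := by
          gcongr
          exact ha i
      _ ≤ _ := by rw [mul_one, one_mul]; gcongr

theorem norm_cexp_sub_taylor_le_cube {x : ℝ} (hx : |x| ≤ 1) :
    ‖Complex.exp (x * Complex.I) - (1 + x * Complex.I - x ^ 2 / 2)‖ ≤ |x| ^ 3 := by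
  have hn : ‖(x : ℂ) * Complex.I‖ = |x| := by simp
  have h := Complex.exp_bound (x := x * Complex.I) (by rwa [hn]) (n := 3) (by norm_num)
  rw [hn] at h
  have e : ∑ m ∈ Finset.range 3, ((x : ℂ) * Complex.I) ^ m / (m.factorial : ℂ)
      = 1 + x * Complex.I - x ^ 2 / 2 := by
    simp [Finset.sum_range_succ, Nat.factorial, mul_pow]
    ring
  rw [e] at h
  refine h.trans ?_
  have : (0 : ℝ) ≤ |x| ^ 3 := by positivity
  norm_num [Nat.factorial]
  linarith

theorem norm_cexp_sub_taylor_le_sq (x : ℝ) :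
    ‖Complex.exp (x * Complex.I) - (1 + x * Complex.I - x ^ 2 / 2)‖ ≤ 4 * x ^ 2 := by
  rcases le_total |x| 1 with hx | hx
  · refine (norm_cexp_sub_taylor_le_cube hx).trans ?_
    rw [← sq_abs x]
    nlinarith [abs_nonneg x, sq_nonneg |x|, mul_nonneg (sq_nonneg |x|) (sub_nonneg.2 hx)]
  · have h1 : ‖Complex.exp (x * Complex.I)‖ = 1 := Complex.norm_exp_ofReal_mul_I x
    have h2 : ‖(x : ℂ) * Complex.I‖ = |x| := by simp
    have h3 : ‖(x : ℂ) ^ 2 / 2‖ = |x| ^ 2 / 2 := by simp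
    calc _ ≤ ‖Complex.exp (x * Complex.I)‖ + (‖(1 : ℂ)‖ + ‖(x : ℂ) * Complex.I‖
          + ‖(x : ℂ) ^ 2 / 2‖) :=
          (norm_sub_le _ _).trans (by
            gcongr
            exact (norm_sub_le _ _).trans (by gcongr; exact norm_add_le _ _))
      _ ≤ _ := by
          rw [h1, h2, h3, norm_one, ← sq_abs x]
          nlinarith

variable {Ω : Type*} [MeasurableSpace Ω] {P : Measure Ω}

theorem integrable_sqTail {X : Ω → ℝ} (hX : MemLp X 2 P) (M : ℝ) :
    Integrable (fun ω => sqTail M (X ω)) P := by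
  refine hX.integrable_sq.mono'
    ((measurable_sqTail M).comp_aemeasurable hX.aemeasurable).aestronglyMeasurable
    (ae_of_all _ fun ω => ?_)
  rw [Real.norm_of_nonneg (sqTail_nonneg _ _)]
  exact sqTail_le_sq _ _

variable [IsProbabilityMeasure P]

theorem memLp_sqTrunc {X : Ω → ℝ} (hX : AEMeasurable X P) (M : ℝ) (p : ENNReal) :
    MemLp (fun ω => sqTrunc M (X ω)) p P := by
  refine MemLp.of_bound ((measurable_sqTrunc M).comp_aemeasurable hX).aestronglyMeasurable
    (M ^ 2) (ae_of_all _ fun ω => ?_)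
  rw [Real.norm_of_nonneg (sqTrunc_nonneg _ _)]
  exact sqTrunc_le _ _

theorem integral_sq_le_of_integral_sqTail_le {X : Ω → ℝ} (hX : MemLp X 2 P) {M ε : ℝ}
    (h : ∫ ω, sqTail M (X ω) ∂P ≤ ε) : ∫ ω, X ω ^ 2 ∂P ≤ M ^ 2 + ε := by
  have h1 : Integrable (fun ω => sqTrunc M (X ω)) P :=
    memLp_one_iff_integrable.1 (memLp_sqTrunc hX.aemeasurable M 1)
  calc ∫ ω, X ω ^ 2 ∂P = ∫ ω, (sqTrunc M (X ω) + sqTail M (X ω)) ∂P := by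
        simp_rw [sqTrunc_add_sqTail]
    _ = ∫ ω, sqTrunc M (X ω) ∂P + ∫ ω, sqTail M (X ω) ∂P :=
        integral_add h1 (integrable_sqTail hX M)
    _ ≤ ∫ _, M ^ 2 ∂P + ε := by
        gcongr
        · exact integrable_const _
        · exact fun ω => sqTrunc_le M _
    _ = _ := by simp

/-- Second order expansion of the characteristic function of a centered variable. -/
theorem norm_charFun_sub_taylor_le {X : Ω → ℝ} (hX : MemLp X 2 P) (h0 : ∫ ω, X ω ∂P = 0)
    {M u : ℝ} (hu : |u| * M ≤ 1) :
    ‖charFun (P.map X) u - ((1 - u ^ 2 * (∫ ω, X ω ^ 2 ∂P) / 2 : ℝ) : ℂ)‖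
      ≤ |u| ^ 3 * |M| ^ 3 + 4 * u ^ 2 * ∫ ω, sqTail M (X ω) ∂P := by
  have hm := hX.aemeasurable
  have hi1 : Integrable X P := hX.integrable (by norm_num)
  have hi2 := hX.integrable_sq
  have hexp : Integrable (fun ω => Complex.exp ((u * X ω : ℝ) * Complex.I)) P := by
    refine Integrable.of_bound (C := 1) (by fun_prop) (ae_of_all _ fun ω => ?_)
    rw [Complex.norm_exp_ofReal_mul_I]
  have hpoly : Integrable (fun ω => (1 + (u * X ω : ℝ) * Complex.I
      - ((u * X ω : ℝ) : ℂ) ^ 2 / 2 : ℂ)) P := by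
    refine ((integrable_const _).add ((hi1.const_mul u).ofReal.mul_const _)).sub ?_
    refine Integrable.div_const ?_ 2
    have := (hi2.const_mul (u ^ 2)).ofReal (𝕜 := ℂ)
    refine this.congr (ae_of_all _ fun ω => ?_)
    change ((u ^ 2 * X ω ^ 2 : ℝ) : ℂ) = _
    push_cast; ring
  have e1 : charFun (P.map X) u = ∫ ω, Complex.exp ((u * X ω : ℝ) * Complex.I) ∂P := by
    rw [charFun_apply_real, integral_map hm (by fun_prop)]
    push_cast; rfl
  have e2 : ((1 - u ^ 2 * (∫ ω, X ω ^ 2 ∂P) / 2 : ℝ) : ℂ) =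
      ∫ ω, (1 + (u * X ω : ℝ) * Complex.I - ((u * X ω : ℝ) : ℂ) ^ 2 / 2 : ℂ) ∂P := by
    have hsq : ∀ ω, ((u * X ω : ℝ) : ℂ) ^ 2 / 2 = ((u ^ 2 / 2 * X ω ^ 2 : ℝ) : ℂ) := by
      intro ω; push_cast; ring
    simp_rw [hsq]
    rw [integral_sub, integral_add (integrable_const _) ((hi1.const_mul u).ofReal.mul_const _),
      integral_mul_const, integral_complex_ofReal, integral_complex_ofReal, integral_const_mul,
      integral_const_mul, h0]
    · simp; ring
    · exact (integrable_const _).add ((hi1.const_mul u).ofReal.mul_const _)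
    · exact (hi2.const_mul _).ofReal
  rw [e1, e2, ← integral_sub hexp hpoly]
  have hb : Integrable (fun ω => |u| ^ 3 * |M| ^ 3 + 4 * u ^ 2 * sqTail M (X ω)) P :=
    (integrable_const _).add ((integrable_sqTail hX M).const_mul _)
  refine (norm_integral_le_of_norm_le hb (ae_of_all _ fun ω => ?_)).trans_eq ?_
  -- Below the threshold `|u * X|` is at most `1` and the cubic remainder applies; above it only the
  -- quadratic remainder is available, and it is charged to the tail.
  · by_cases h : M < |X ω|
    · refine (norm_cexp_sub_taylor_le_sq _).trans ?_
      rw [sqTail, if_pos h]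
      have : 0 ≤ |u| ^ 3 * |M| ^ 3 := by positivity
      nlinarith
    · rw [not_lt] at h
      have h2 : |u * X ω| ≤ |u| * M := by rw [abs_mul]; gcongr
      refine (norm_cexp_sub_taylor_le_cube (h2.trans hu)).trans ?_
      have h3 : 0 ≤ 4 * u ^ 2 * sqTail M (X ω) := mul_nonneg (by positivity) (sqTail_nonneg _ _)
      have h4 : |u * X ω| ^ 3 ≤ (|u| * |M|) ^ 3 :=
        pow_le_pow_left₀ (abs_nonneg _) (h2.trans (by gcongr; exact le_abs_self M)) 3
      rw [mul_pow] at h4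
      linarith
  · rw [integral_add (integrable_const _) ((integrable_sqTail hX M).const_mul _),
      integral_const, integral_const_mul]
    simp

/-- The Taylor polynomial is replaced by an exponential, so that a product over a row becomes
exactly Gaussian. The factor `u ^ 2` is pulled out because its sum over a row stays bounded. -/
theorem norm_charFun_sub_gaussian_le {X : Ω → ℝ} (hX : MemLp X 2 P) (h0 : ∫ ω, X ω ∂P = 0)
    {M C u : ℝ} (hu : |u| * M ≤ 1) (hC : ∫ ω, X ω ^ 2 ∂P ≤ C) (hCu : u ^ 2 * C ≤ 1) :
    ‖charFun (P.map X) u - (Real.exp (-(u ^ 2 * (∫ ω, X ω ^ 2 ∂P) / 2)) : ℂ)‖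
      ≤ u ^ 2 * (|u| * |M| ^ 3 + 4 * ∫ ω, sqTail M (X ω) ∂P + u ^ 2 * C ^ 2) := by
  set σ := ∫ ω, X ω ^ 2 ∂P with hσ
  have hσ0 : 0 ≤ σ := integral_nonneg fun ω => sq_nonneg _
  have h1 := norm_charFun_sub_taylor_le hX h0 hu
  have hy : u ^ 2 * σ ≤ u ^ 2 * C := by gcongr
  have hy0 : 0 ≤ u ^ 2 * σ := by positivity
  have hyn : ‖-(u ^ 2 * σ / 2)‖ = u ^ 2 * σ / 2 := by
    rw [norm_neg, Real.norm_of_nonneg (by positivity)]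
  have h2 : ‖Real.exp (-(u ^ 2 * σ / 2)) - 1 - -(u ^ 2 * σ / 2)‖ ≤ (u ^ 2 * σ / 2) ^ 2 := by
    have := Real.norm_exp_sub_one_sub_id_le (x := -(u ^ 2 * σ / 2)) (by rw [hyn]; linarith)
    rwa [hyn] at this
  have h3 : ‖((1 - u ^ 2 * σ / 2 : ℝ) : ℂ) - (Real.exp (-(u ^ 2 * σ / 2)) : ℂ)‖
      ≤ u ^ 2 * (u ^ 2 * C ^ 2) := by
    rw [← Complex.ofReal_sub, Complex.norm_real, norm_sub_rev]
    calc _ = ‖Real.exp (-(u ^ 2 * σ / 2)) - 1 - -(u ^ 2 * σ / 2)‖ := by congr 1; ring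
      _ ≤ (u ^ 2 * σ / 2) ^ 2 := h2
      _ ≤ (u ^ 2 * C) ^ 2 := pow_le_pow_left₀ (by positivity) (by linarith) 2
      _ = _ := by ring
  calc _ = ‖(charFun (P.map X) u - ((1 - u ^ 2 * σ / 2 : ℝ) : ℂ)) +
        (((1 - u ^ 2 * σ / 2 : ℝ) : ℂ) - (Real.exp (-(u ^ 2 * σ / 2)) : ℂ))‖ := by congr 1; ring
    _ ≤ _ := norm_add_le _ _
    _ ≤ (|u| ^ 3 * |M| ^ 3 + 4 * u ^ 2 * ∫ ω, sqTail M (X ω) ∂P) + u ^ 2 * (u ^ 2 * C ^ 2) :=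
        add_le_add h1 h3
    _ = _ := by rw [pow_succ |u| 2, sq_abs]; ring

/-! ### Triangular arrays: central limit theorem and the t-statistic -/

/-- A triangular array of rowwise independent centered variables whose squares are uniformly
integrable and whose variances are eventually bounded away from `0`. -/
structure IsCenteredArray {Ω : Type*} [MeasurableSpace Ω] (P : Measure Ω)
    (s : (r : ℕ) → Fin r → Ω → ℝ) : Prop where
  measurable : ∀ r i, Measurable (s r i)
  memLp : ∀ r i, MemLp (s r i) 2 P
  indep : ∀ r, iIndepFun (s r) P
  mean : ∀ r i, ∫ ω, s r i ω ∂P = 0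
  tail : ∀ ε > 0, ∃ M, ∀ r i, ∫ ω, sqTail M (s r i ω) ∂P ≤ ε
  var : ∃ v > 0, ∀ᶠ r in atTop, ∀ i, v ≤ ∫ ω, s r i ω ^ 2 ∂P

/-- The variance of the sum of row `r`. -/
noncomputable def rowVar {Ω : Type*} [MeasurableSpace Ω] (P : Measure Ω)
    (s : (r : ℕ) → Fin r → Ω → ℝ) (r : ℕ) : ℝ := ∑ i, ∫ ω, s r i ω ^ 2 ∂P

namespace IsCenteredArray

variable {Ω : Type*} [MeasurableSpace Ω] {P : Measure Ω}
  {s : (r : ℕ) → Fin r → Ω → ℝ}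

theorem exists_mul_le_rowVar (h : IsCenteredArray P s) :
    ∃ v > 0, ∀ᶠ r : ℕ in atTop, v * r ≤ rowVar P s r := by
  obtain ⟨v, hv, hr⟩ := h.var
  refine ⟨v, hv, hr.mono fun r hr => ?_⟩
  calc v * r = ∑ _i : Fin r, v := by simp [mul_comm]
    _ ≤ _ := Finset.sum_le_sum fun i _ => hr i

theorem charFun_normalized_sum (h : IsCenteredArray P s) (r : ℕ) (t : ℝ) :
    charFun (P.map fun ω => (√(rowVar P s r))⁻¹ * ∑ i, s r i ω) t =
      ∏ i, charFun (P.map (s r i)) ((√(rowVar P s r))⁻¹ * t) := by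
  have hm := h.measurable r
  rw [charFun_map_mul_comp (by fun_prop),
    (h.indep r).charFun_map_fun_sum_eq_prod fun i => (hm i).aemeasurable]
  simp

variable [IsProbabilityMeasure P]

theorem exists_second_moment_le (h : IsCenteredArray P s) :
    ∃ C, ∀ r i, ∫ ω, s r i ω ^ 2 ∂P ≤ C := by
  obtain ⟨M, hM⟩ := h.tail 1 one_pos
  exact ⟨M ^ 2 + 1, fun r i => integral_sq_le_of_integral_sqTail_le (h.memLp r i) (hM r i)⟩

/-- Lindeberg's argument: the rescaled frequency `u r` tends to `0` while `r * u r ^ 2` stays below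
`t ^ 2 / v`, so the `r` individual errors add up to something small. -/
theorem tendsto_charFun_normalized_sum (h : IsCenteredArray P s) (t : ℝ) :
    Tendsto (fun r : ℕ => charFun (P.map fun ω => (√(rowVar P s r))⁻¹ * ∑ i, s r i ω) t)
      atTop (𝓝 (Complex.exp (-(t ^ 2 / 2 : ℝ)))) := by
  obtain ⟨v, hv, hvr⟩ := h.exists_mul_le_rowVar
  obtain ⟨C, hC⟩ := h.exists_second_moment_le
  set u : ℕ → ℝ := fun r => (√(rowVar P s r))⁻¹ * t with hu
  have hV : Tendsto (rowVar P s) atTop atTop :=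
    tendsto_atTop_mono' _ hvr (tendsto_natCast_atTop_atTop.const_mul_atTop hv)
  have hu0 : Tendsto u atTop (𝓝 0) := by
    have := (tendsto_inv_atTop_zero.comp (Real.tendsto_sqrt_atTop.comp hV)).mul_const t
    simpa using this
  set w := t ^ 2 / v with hw
  have hw0 : 0 ≤ w := by positivity
  rw [Metric.tendsto_nhds]
  intro ε hε
  -- With `r * u r ^ 2 ≤ w`, the tail terms total at most `w * 4 * (ε / (8 * (w + 1))) ≤ ε / 2`;
  -- adding `1` to `w` covers `t = 0`.
  obtain ⟨M, hM⟩ := h.tail (ε / (8 * (w + 1))) (by positivity)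
  have hrem : Tendsto (fun r => w * (|u r| * |M| ^ 3 + u r ^ 2 * C ^ 2)) atTop (𝓝 0) := by
    simpa using ((hu0.abs.mul_const (|M| ^ 3)).add ((hu0.pow 2).mul_const (C ^ 2))).const_mul w
  have huM : Tendsto (fun r => |u r| * M) atTop (𝓝 0) := by simpa using hu0.abs.mul_const M
  have huC : Tendsto (fun r => u r ^ 2 * C) atTop (𝓝 0) := by simpa using (hu0.pow 2).mul_const C
  filter_upwards [hvr, eventually_gt_atTop 0, hrem.eventually_lt_const (half_pos hε),
    huM.eventually_le_const one_pos, huC.eventually_le_const one_pos] with r hr hr0 h1 h2 h3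
  have hr0' : (0 : ℝ) < r := Nat.cast_pos.2 hr0
  have hVpos : 0 < rowVar P s r := lt_of_lt_of_le (by positivity) hr
  have husq : u r ^ 2 * rowVar P s r = t ^ 2 := by
    simp only [hu, mul_pow, inv_pow, Real.sq_sqrt hVpos.le]
    field_simp
  have hru : r * u r ^ 2 ≤ w := by
    rw [hw, le_div_iff₀ hv, ← husq]
    nlinarith [sq_nonneg (u r)]
  have hexp : Complex.exp (-(t ^ 2 / 2 : ℝ)) =
      ∏ i, (Real.exp (-(u r ^ 2 * (∫ ω, s r i ω ^ 2 ∂P) / 2)) : ℂ) := by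
    rw [← Complex.ofReal_prod, ← Real.exp_sum, ← Complex.ofReal_neg, ← Complex.ofReal_exp]
    congr 2
    rw [Finset.sum_neg_distrib, ← Finset.sum_div, ← Finset.mul_sum, ← husq]
    rfl
  rw [dist_eq_norm, h.charFun_normalized_sum, hexp]
  have hprob : ∀ i, IsProbabilityMeasure (P.map (s r i)) := fun i =>
    Measure.isProbabilityMeasure_map (h.measurable r i).aemeasurable
  refine (norm_prod_sub_prod_le_sum _ _ _ (fun i => norm_charFun_le_one _)
    fun i => ?_).trans_lt ?_
  · rw [Complex.norm_real, Real.norm_of_nonneg (Real.exp_pos _).le, Real.exp_le_one_iff,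
      neg_nonpos]
    have : 0 ≤ ∫ ω, s r i ω ^ 2 ∂P := integral_nonneg fun ω => sq_nonneg _
    positivity
  · calc _ ≤ ∑ _i : Fin r, u r ^ 2 *
          (|u r| * |M| ^ 3 + 4 * (ε / (8 * (w + 1))) + u r ^ 2 * C ^ 2) := by
          refine Finset.sum_le_sum fun i _ =>
            (norm_charFun_sub_gaussian_le (h.memLp r i) (h.mean r i) h2 (hC r i) h3).trans ?_
          gcongr
          exact hM r i
      _ = r * u r ^ 2 * (|u r| * |M| ^ 3 + 4 * (ε / (8 * (w + 1))) + u r ^ 2 * C ^ 2) := by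
          simp [mul_assoc]
      _ ≤ w * (|u r| * |M| ^ 3 + 4 * (ε / (8 * (w + 1))) + u r ^ 2 * C ^ 2) := by gcongr
      _ = w * (|u r| * |M| ^ 3 + u r ^ 2 * C ^ 2) + w / (w + 1) * (ε / 2) := by
          field_simp; ring
      _ < ε / 2 + 1 * (ε / 2) := by
          refine add_lt_add_of_lt_of_le h1 ?_
          gcongr
          exact div_le_one_of_le₀ (by linarith) (by positivity)
      _ = ε := by ring

/-- Central limit theorem for centered arrays. -/
theorem tendstoInDistribution_normalized_sum (h : IsCenteredArray P s) :
    TendstoInDistribution (fun (r : ℕ) ω => (√(rowVar P s r))⁻¹ * ∑ i, s r i ω) atTop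
      (id : ℝ → ℝ) (fun _ => P) (gaussianReal 0 1) where
  forall_aemeasurable r := by
    have hm := h.measurable r
    fun_prop
  tendsto := by
    refine ProbabilityMeasure.tendsto_iff_tendsto_charFun.2 fun t => ?_
    have := h.tendsto_charFun_normalized_sum t
    simpa [charFun_gaussianReal, Measure.map_id, neg_div] using this

end IsCenteredArray

/-! ### Consistency of the sample variance -/

theorem sampleVariance_eq {r : ℕ} (hr : r ≠ 0) (x : Fin r → ℝ) :
    sampleVariance x = (∑ i, x i ^ 2 - (∑ i, x i) ^ 2 / r) / ((r : ℝ) - 1) := by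
  have hr' : (r : ℝ) ≠ 0 := Nat.cast_ne_zero.2 hr
  unfold sampleVariance sampleMean
  congr 1
  simp_rw [sub_sq]
  rw [Finset.sum_add_distrib, Finset.sum_sub_distrib, ← Finset.sum_mul, ← Finset.mul_sum]
  simp only [Finset.sum_const, Finset.card_univ, Fintype.card_fin, nsmul_eq_mul]
  field_simp
  ring

theorem measurable_sampleVariance {r : ℕ} : Measurable (sampleVariance (r := r)) := by
  unfold sampleVariance sampleMean
  fun_prop

namespace IsCenteredArray

variable {Ω : Type*} [MeasurableSpace Ω] {P : Measure Ω} [IsProbabilityMeasure P]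
  {s : (r : ℕ) → Fin r → Ω → ℝ}

theorem integral_sum_sq_eq_rowVar (h : IsCenteredArray P s) (r : ℕ) :
    ∫ ω, (∑ i, s r i ω) ^ 2 ∂P = rowVar P s r := by
  have hvar : Var[∑ i, s r i; P] = ∑ i, Var[s r i; P] :=
    IndepFun.variance_sum (fun i _ => h.memLp r i) fun i _ j _ hij => (h.indep r).indepFun hij
  have hmeas : AEMeasurable (∑ i, s r i) P :=
    Finset.aemeasurable_sum _ fun i _ => (h.measurable r i).aemeasurable
  have h0 : P[∑ i, s r i] = 0 := by
    simp only [Finset.sum_apply]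
    rw [integral_finsetSum _ fun i _ => (h.memLp r i).integrable (by norm_num)]
    simp [h.mean]
  rw [variance_of_integral_eq_zero hmeas h0] at hvar
  simp only [Finset.sum_apply] at hvar
  rw [hvar]
  exact Finset.sum_congr rfl fun i _ =>
    variance_of_integral_eq_zero (h.measurable r i).aemeasurable (h.mean r i)

/-- Independence makes the variance of the truncated sum linear in `r`, and `|y| ≤ y ^ 2 / c + c`
turns it into an `L¹` bound. The parameter `c` is later taken to be a small multiple of `r`. -/
theorem integral_abs_sum_sqTrunc_sub_le (h : IsCenteredArray P s) (r : ℕ) (M : ℝ) {c : ℝ}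
    (hc : 0 < c) :
    ∫ ω, |∑ i, (sqTrunc M (s r i ω) - ∫ ω', sqTrunc M (s r i ω') ∂P)| ∂P
      ≤ r * M ^ 4 / c + c := by
  set f : Fin r → Ω → ℝ := fun i ω => sqTrunc M (s r i ω) with hf
  have hfL : ∀ i, MemLp (f i) 2 P := fun i => memLp_sqTrunc (h.measurable r i).aemeasurable M 2
  have hfi : ∀ i, Integrable (f i) P := fun i => (hfL i).integrable (by norm_num)
  have hind : iIndepFun f P := (h.indep r).comp (fun _ => sqTrunc M) fun _ => measurable_sqTrunc M
  have hvar : Var[∑ i, f i; P] = ∑ i, Var[f i; P] :=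
    IndepFun.variance_sum (fun i _ => hfL i) fun i _ j _ hij => hind.indepFun hij
  have hle : Var[∑ i, f i; P] ≤ r * M ^ 4 := by
    rw [hvar]
    calc _ ≤ ∑ _i : Fin r, M ^ 4 := by
          refine Finset.sum_le_sum fun i _ =>
            (variance_le_expectation_sq (hfL i).aestronglyMeasurable).trans ?_
          calc ∫ ω, (f i ^ 2) ω ∂P ≤ ∫ _, M ^ 4 ∂P := by
                refine integral_mono (hfL i).integrable_sq (integrable_const _) fun ω => ?_
                have := pow_le_pow_left₀ (sqTrunc_nonneg M (s r i ω)) (sqTrunc_le M _) 2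
                calc _ ≤ (M ^ 2) ^ 2 := this
                  _ = M ^ 4 := by ring
            _ = M ^ 4 := by simp
      _ = _ := by simp
  have hsumL : MemLp (∑ i, f i) 2 P := memLp_finsetSum' _ fun i _ => hfL i
  have hY : ∀ ω, ∑ i, (f i ω - ∫ ω', f i ω' ∂P) = (∑ i, f i) ω - P[∑ i, f i] := by
    intro ω
    simp only [Finset.sum_apply, Finset.sum_sub_distrib]
    rw [integral_finsetSum _ fun i _ => hfi i]
  have hYL : MemLp (fun ω => (∑ i, f i) ω - P[∑ i, f i]) 2 P := hsumL.sub (memLp_const _)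
  change ∫ ω, |∑ i, (f i ω - ∫ ω', f i ω' ∂P)| ∂P ≤ _
  simp_rw [hY]
  calc _ ≤ ∫ ω, (((∑ i, f i) ω - P[∑ i, f i]) ^ 2 / c + c) ∂P := by
        refine integral_mono (hYL.integrable (by norm_num)).abs
          ((hYL.integrable_sq.div_const c).add (integrable_const c)) fun ω => ?_
        set y := (∑ i, f i) ω - P[∑ i, f i]
        change |y| ≤ y ^ 2 / c + c
        rw [div_add' _ _ _ hc.ne', le_div_iff₀ hc, ← sq_abs y]
        nlinarith [sq_nonneg (|y| - c), abs_nonneg y]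
    _ = Var[∑ i, f i; P] / c + c := by
        rw [integral_add (hYL.integrable_sq.div_const c) (integrable_const c), integral_div,
          variance_eq_integral hsumL.aemeasurable]
        simp
    _ ≤ _ := by gcongr

/-- No cancellation is needed: a nonnegative variable deviates from its mean by at most twice that
mean on average. -/
theorem integral_abs_sum_sqTail_sub_le (h : IsCenteredArray P s) (r : ℕ) {M ε : ℝ}
    (hM : ∀ i, ∫ ω, sqTail M (s r i ω) ∂P ≤ ε) :
    ∫ ω, |∑ i, (sqTail M (s r i ω) - ∫ ω', sqTail M (s r i ω') ∂P)| ∂P ≤ 2 * r * ε := by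
  have hi := fun i => integrable_sqTail (h.memLp r i) M
  have hi' : ∀ i, Integrable
      (fun ω => |sqTail M (s r i ω) - ∫ ω', sqTail M (s r i ω') ∂P|) P :=
    fun i => ((hi i).sub (integrable_const _)).abs
  calc _ ≤ ∫ ω, ∑ i, |sqTail M (s r i ω) - ∫ ω', sqTail M (s r i ω') ∂P| ∂P := by
        refine integral_mono (integrable_finsetSum _ fun i _ =>
          (hi i).sub (integrable_const _)).abs (integrable_finsetSum _ fun i _ => hi' i)
          fun ω => Finset.abs_sum_le_sum_abs _ _
    _ = ∑ i, ∫ ω, |sqTail M (s r i ω) - ∫ ω', sqTail M (s r i ω') ∂P| ∂P :=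
        integral_finsetSum _ fun i _ => hi' i
    _ ≤ ∑ _i : Fin r, 2 * ε := by
        refine Finset.sum_le_sum fun i _ => ?_
        have h0 : 0 ≤ ∫ ω', sqTail M (s r i ω') ∂P := integral_nonneg fun ω => sqTail_nonneg _ _
        calc _ ≤ ∫ ω, (sqTail M (s r i ω) + ∫ ω', sqTail M (s r i ω') ∂P) ∂P := by
              refine integral_mono (hi' i) ((hi i).add (integrable_const _)) fun ω => ?_
              refine (abs_sub _ _).trans_eq ?_
              rw [abs_of_nonneg (sqTail_nonneg _ _), abs_of_nonneg h0]
          _ = 2 * ∫ ω', sqTail M (s r i ω') ∂P := by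
              rw [integral_add (hi i) (integrable_const _), integral_const]
              simp; ring
          _ ≤ _ := by gcongr; exact hM i
    _ = _ := by simp; ring

theorem integrable_abs_sum_sq_sub (h : IsCenteredArray P s) (r : ℕ) (c : ℝ) :
    Integrable (fun ω => |∑ i, s r i ω ^ 2 - c|) P :=
  ((integrable_finsetSum _ fun i _ => (h.memLp r i).integrable_sq).sub (integrable_const c)).abs

/-- Law of large numbers for the squares in a centered array. -/
theorem tendsto_integral_abs_sum_sq_sub (h : IsCenteredArray P s) :
    Tendsto (fun r : ℕ => (∫ ω, |∑ i, s r i ω ^ 2 - rowVar P s r| ∂P) / r) atTop (𝓝 0) := by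
  rw [Metric.tendsto_nhds]
  intro ε hε
  -- After division by `r`, the tails cost `ε / 4`, the choice `c = ε / 4 * r` costs another `ε /
  -- 4`, and the variance term is eventually below `ε / 4`.
  obtain ⟨M, hM⟩ := h.tail (ε / 8) (by positivity)
  have hlim : Tendsto (fun r : ℕ => M ^ 4 / (ε / 4) / (r : ℝ)) atTop (𝓝 0) :=
    tendsto_const_div_atTop_nhds_zero_nat _
  filter_upwards [hlim.eventually_lt_const (by positivity : 0 < ε / 4), eventually_gt_atTop 0]
    with r h1 hr
  have hr' : (0 : ℝ) < r := Nat.cast_pos.2 hr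
  have hi := fun i => integrable_sqTail (h.memLp r i) M
  have hj : ∀ i, Integrable (fun ω => sqTrunc M (s r i ω)) P := fun i =>
    memLp_one_iff_integrable.1 (memLp_sqTrunc (h.measurable r i).aemeasurable M 1)
  have e : ∀ ω, ∑ i, s r i ω ^ 2 - rowVar P s r =
      ∑ i, (sqTrunc M (s r i ω) - ∫ ω', sqTrunc M (s r i ω') ∂P) +
        ∑ i, (sqTail M (s r i ω) - ∫ ω', sqTail M (s r i ω') ∂P) := by
    intro ω
    rw [rowVar, ← Finset.sum_add_distrib, ← Finset.sum_sub_distrib]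
    refine Finset.sum_congr rfl fun i _ => ?_
    have : ∫ ω', s r i ω' ^ 2 ∂P =
        ∫ ω', sqTrunc M (s r i ω') ∂P + ∫ ω', sqTail M (s r i ω') ∂P := by
      rw [← integral_add (hj i) (hi i)]
      simp_rw [sqTrunc_add_sqTail]
    rw [this, ← sqTrunc_add_sqTail M (s r i ω)]
    ring
  have hb : ∫ ω, |∑ i, s r i ω ^ 2 - rowVar P s r| ∂P ≤
      (r * M ^ 4 / (ε / 4 * r) + ε / 4 * r) + 2 * r * (ε / 8) := by
    refine le_trans ?_ (add_le_add (h.integral_abs_sum_sqTrunc_sub_le r M (c := ε / 4 * r)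
      (by positivity)) (h.integral_abs_sum_sqTail_sub_le r (hM r)))
    have i1 : Integrable
        (fun ω => |∑ i, (sqTrunc M (s r i ω) - ∫ ω', sqTrunc M (s r i ω') ∂P)|) P :=
      (integrable_finsetSum _ fun i _ => (hj i).sub (integrable_const _)).abs
    have i2 : Integrable
        (fun ω => |∑ i, (sqTail M (s r i ω) - ∫ ω', sqTail M (s r i ω') ∂P)|) P :=
      (integrable_finsetSum _ fun i _ => (hi i).sub (integrable_const _)).abs
    rw [← integral_add i1 i2]
    refine integral_mono (h.integrable_abs_sum_sq_sub r _) (i1.add i2) fun ω => ?_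
    change |∑ i, s r i ω ^ 2 - rowVar P s r| ≤ _
    rw [e ω]
    exact abs_add_le _ _
  rw [Real.dist_eq, sub_zero, abs_of_nonneg (by positivity), div_lt_iff₀ hr']
  refine hb.trans_lt ?_
  rw [div_lt_iff₀ hr'] at h1
  have e2 : r * M ^ 4 / (ε / 4 * r) = M ^ 4 / (ε / 4) := by field_simp
  rw [e2]
  nlinarith

/-- The sample variance of row `r`, relative to its asymptotic value. -/
noncomputable def varRatio (P : Measure Ω) (s : (r : ℕ) → Fin r → Ω → ℝ) (r : ℕ) (ω : Ω) : ℝ :=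
  sampleVariance (fun i => s r i ω) * r / rowVar P s r

theorem tendsto_integral_abs_varRatio_sub_one (h : IsCenteredArray P s) :
    Tendsto (fun r : ℕ => ∫ ω, |varRatio P s r ω - 1| ∂P) atTop (𝓝 0) := by
  obtain ⟨v, hv, hvr⟩ := h.exists_mul_le_rowVar
  have hlim : Tendsto (fun r : ℕ => 2 * ((∫ ω, |∑ i, s r i ω ^ 2 - rowVar P s r| ∂P) / r / v
      + 2 / r)) atTop (𝓝 0) := by
    have := ((h.tendsto_integral_abs_sum_sq_sub.div_const v).add
      (tendsto_const_div_atTop_nhds_zero_nat 2)).const_mul 2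
    simpa using this
  refine squeeze_zero' (Eventually.of_forall fun r => integral_nonneg fun ω => abs_nonneg _) ?_
    hlim
  filter_upwards [hvr, eventually_ge_atTop 2] with r hr hr2
  have hr2' : (2 : ℝ) ≤ r := by exact_mod_cast hr2
  have hV : 0 < rowVar P s r := lt_of_lt_of_le (by positivity) hr
  have hi1 := h.integrable_abs_sum_sq_sub r (rowVar P s r)
  have hSL : MemLp (fun ω => ∑ i, s r i ω) 2 P := memLp_finsetSum _ fun i _ => h.memLp r i
  have hi2 : Integrable (fun ω => (∑ i, s r i ω) ^ 2 / (r * rowVar P s r)) P :=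
    hSL.integrable_sq.div_const _
  have hi12 : Integrable (fun ω => |∑ i, s r i ω ^ 2 - rowVar P s r| / rowVar P s r +
      (∑ i, s r i ω) ^ 2 / (r * rowVar P s r)) P := (hi1.div_const _).add hi2
  have hi3 : Integrable (fun ω => |∑ i, s r i ω ^ 2 - rowVar P s r| / rowVar P s r +
      (∑ i, s r i ω) ^ 2 / (r * rowVar P s r) + 1 / r) P :=
    hi12.add (integrable_const _)
  calc ∫ ω, |varRatio P s r ω - 1| ∂P ≤
      ∫ ω, 2 * (|∑ i, s r i ω ^ 2 - rowVar P s r| / rowVar P s r +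
        (∑ i, s r i ω) ^ 2 / (r * rowVar P s r) + 1 / r) ∂P := by
        refine integral_mono_of_nonneg (ae_of_all _ fun ω => abs_nonneg _) (hi3.const_mul 2)
          (ae_of_all _ fun ω => ?_)
        simp only [varRatio, sampleVariance_eq (by omega : r ≠ 0)]
        set Q := ∑ i, s r i ω ^ 2
        set S := ∑ i, s r i ω
        set W := rowVar P s r
        have hr1 : (r : ℝ) - 1 ≠ 0 := by linarith
        -- The first term is small by the law of large numbers; the second has mean `1 / r`, because
        -- `S ^ 2` has mean `W`.
        have e : (Q - S ^ 2 / r) / ((r : ℝ) - 1) * r / W - 1 =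
            r / (r - 1) * ((Q - W) / W - S ^ 2 / (r * W) + 1 / r) := by
          field_simp
          ring
        have hc : (r : ℝ) / (r - 1) ≤ 2 := by
          rw [div_le_iff₀ (by linarith)]; linarith
        have hc0 : (0 : ℝ) ≤ r / (r - 1) := div_nonneg (by linarith) (by linarith)
        rw [e, abs_mul, abs_of_nonneg hc0]
        refine mul_le_mul hc ?_ (abs_nonneg _) zero_le_two
        calc _ ≤ |(Q - W) / W - S ^ 2 / (r * W)| + |(1 / r : ℝ)| := abs_add_le _ _
          _ ≤ |(Q - W) / W| + |S ^ 2 / (r * W)| + |(1 / r : ℝ)| := by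
              gcongr; exact abs_sub _ _
          _ = _ := by
              rw [abs_div, abs_of_pos hV, abs_of_nonneg (by positivity : 0 ≤ S ^ 2 / (r * W)),
                abs_of_nonneg (by positivity : (0 : ℝ) ≤ 1 / r)]
    _ = 2 * ((∫ ω, |∑ i, s r i ω ^ 2 - rowVar P s r| ∂P) / rowVar P s r +
          rowVar P s r / (r * rowVar P s r) + 1 / r) := by
        rw [integral_const_mul, integral_add hi12 (integrable_const _),
          integral_add (hi1.div_const _) hi2, integral_div, integral_div,
          h.integral_sum_sq_eq_rowVar, integral_const]
        simp
    _ = 2 * ((∫ ω, |∑ i, s r i ω ^ 2 - rowVar P s r| ∂P) / rowVar P s r + 2 / r) := by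
        field_simp
        ring
    _ ≤ _ := by
        rw [div_div, mul_comm (r : ℝ) v]
        gcongr

end IsCenteredArray

/-! ### Limit law of the t-statistic and level of the t-test -/

theorem measurable_sampleMean {r : ℕ} : Measurable (sampleMean (r := r)) := by
  unfold sampleMean
  fun_prop

theorem measurable_tStatistic {r : ℕ} : Measurable (tStatistic (r := r)) := by
  unfold tStatistic
  exact measurable_sampleMean.div (measurable_sampleVariance.sqrt.div_const _)

theorem sampleVariance_nonneg {r : ℕ} (hr : 1 ≤ r) (x : Fin r → ℝ) : 0 ≤ sampleVariance x := by
  have : (1 : ℝ) ≤ r := by exact_mod_cast hr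
  exact div_nonneg (Finset.sum_nonneg fun i _ => sq_nonneg _) (by linarith)

theorem abs_sqrt_sub_one_le {x : ℝ} (hx : 0 ≤ x) : |√x - 1| ≤ |x - 1| := by
  have h : x - 1 = (√x - 1) * (√x + 1) := by nlinarith [Real.mul_self_sqrt hx]
  rw [h, abs_mul]
  refine le_mul_of_one_le_right (abs_nonneg _) ?_
  rw [abs_of_nonneg (by positivity)]
  linarith [Real.sqrt_nonneg x]

/-- Every level in `(0, 1)` is an upper tail probability of the standard Gaussian. -/
theorem exists_gaussian_tail_eq {β : ℝ} (hβ : β ∈ Set.Ioo (0 : ℝ) 1) :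
    ∃ x, (gaussianReal 0 1).real (Set.Ioi x) = β := by
  have hcont : Continuous (cdf (gaussianReal 0 1)) := by
    rw [continuous_iff_continuousAt]
    intro x
    -- Absence of atoms makes the distribution function continuous; the intermediate value theorem
    -- then yields every level.
    have hs : (cdf (gaussianReal 0 1)).measure {x} = 0 := by
      rw [measure_cdf]
      exact (nullSingletonClass_gaussianReal one_ne_zero).measure_singleton x
    rw [StieltjesFunction.measure_singleton, ENNReal.ofReal_eq_zero, sub_nonpos] at hs
    rw [(monotone_cdf _).continuousAt_iff_leftLim_eq_rightLim, StieltjesFunction.rightLim_eq]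
    exact le_antisymm ((monotone_cdf _).leftLim_le le_rfl) hs
  obtain ⟨a, ha⟩ := ((tendsto_cdf_atBot (gaussianReal 0 1)).eventually_lt_const
    (sub_pos.2 hβ.2)).exists
  obtain ⟨b, hb⟩ := ((tendsto_cdf_atTop (gaussianReal 0 1)).eventually_const_lt
    (sub_lt_self 1 hβ.1)).exists
  obtain ⟨x, hx⟩ := mem_range_of_exists_le_of_exists_ge hcont ⟨a, ha.le⟩ ⟨b, hb.le⟩
  refine ⟨x, ?_⟩
  rw [cdf_eq_real] at hx
  rw [← Set.compl_Iic, probReal_compl_eq_one_sub measurableSet_Iic, hx]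
  ring

namespace IsCenteredArray

variable {Ω : Type*} [MeasurableSpace Ω] {P : Measure Ω}
  {s : (r : ℕ) → Fin r → Ω → ℝ}

theorem measurable_varRatio (h : IsCenteredArray P s) (r : ℕ) : Measurable (varRatio P s r) :=
  ((measurable_sampleVariance.comp (measurable_pi_lambda _ (h.measurable r))).mul_const _).div_const
    _

theorem varRatio_nonneg {r : ℕ} (hr : 1 ≤ r) (ω : Ω) : 0 ≤ varRatio P s r ω := by
  refine div_nonneg (mul_nonneg (sampleVariance_nonneg hr _) (Nat.cast_nonneg r)) ?_
  exact Finset.sum_nonneg fun i _ => integral_nonneg fun ω => sq_nonneg _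

/-- Clearing the random denominator makes the event linear in the normalized sum and `√(varRatio P s
r ω)`, so Slutsky's theorem is needed only for a globally continuous map. -/
theorem lt_tStatistic_iff {r : ℕ} (hV : 0 < rowVar P s r) {ω : Ω}
    (hD : 0 < varRatio P s r ω) (x : ℝ) :
    x < tStatistic (fun i => s r i ω) ↔
      0 < (√(rowVar P s r))⁻¹ * ∑ i, s r i ω + -x * √(varRatio P s r ω) := by
  have hr : (0 : ℝ) < r := by
    rcases Nat.eq_zero_or_pos r with rfl | h0
    · simp [varRatio] at hD
    · exact_mod_cast h0
  have hσ : 0 < sampleVariance (fun i => s r i ω) := by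
    by_contra hc
    exact hD.not_ge (div_nonpos_of_nonpos_of_nonneg
      (mul_nonpos_of_nonpos_of_nonneg (not_lt.1 hc) hr.le) hV.le)
  have hsV : 0 < √(rowVar P s r) := Real.sqrt_pos.2 hV
  have hsσ := Real.sqrt_pos.2 hσ
  have hsr := Real.sqrt_pos.2 hr
  have e : √(varRatio P s r ω) =
      √(sampleVariance fun i => s r i ω) * √r / √(rowVar P s r) := by
    rw [varRatio, Real.sqrt_div (by positivity), Real.sqrt_mul hσ.le]
  rw [e, tStatistic, sampleMean, lt_div_iff₀ (by positivity), ← sub_pos]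
  set S := ∑ i, s r i ω
  have e2 : (√(rowVar P s r))⁻¹ * S +
      -x * (√(sampleVariance fun i => s r i ω) * √r / √(rowVar P s r)) =
      (S / r - x * (√(sampleVariance fun i => s r i ω) / √r)) * (r / √(rowVar P s r)) := by
    have hs2 : √(r : ℝ) ^ 2 = r := Real.sq_sqrt hr.le
    field_simp
    linear_combination -(x * √(sampleVariance fun i => s r i ω)) * hs2
  rw [e2]
  exact (mul_pos_iff_of_pos_right (by positivity)).symm

theorem integrable_varRatio (h : IsCenteredArray P s) (r : ℕ) : Integrable (varRatio P s r) P := by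
  refine Integrable.div_const (Integrable.mul_const (Integrable.div_const ?_ _) _) _
  refine integrable_finsetSum _ fun i _ => MemLp.integrable_sq ?_
  refine (h.memLp r i).sub ?_
  have hS : MemLp (fun ω => ∑ i, s r i ω) 2 P := memLp_finsetSum _ fun i _ => h.memLp r i
  simpa only [sampleMean, div_eq_mul_inv] using hS.mul_const ((r : ℝ)⁻¹)

variable [IsProbabilityMeasure P]

/-- Markov's inequality applied to the `L¹` convergence of the ratio, since the square root does not
increase the distance to `1`. -/
theorem tendstoInMeasure_sqrt_varRatio (h : IsCenteredArray P s) :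
    TendstoInMeasure P (fun r ω => √(varRatio P s r ω)) atTop fun _ => 1 := by
  rw [tendstoInMeasure_iff_measureReal_norm]
  intro ε hε
  have hlim := h.tendsto_integral_abs_varRatio_sub_one.div_const ε
  rw [zero_div] at hlim
  refine squeeze_zero' (Eventually.of_forall fun r => measureReal_nonneg) ?_ hlim
  filter_upwards [eventually_ge_atTop 1] with r hr
  rw [le_div_iff₀ hε, mul_comm]
  refine le_trans ?_ (mul_meas_ge_le_integral_of_nonneg (ae_of_all _ fun ω => abs_nonneg _)
    ((h.integrable_varRatio r).sub (integrable_const 1)).abs ε)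
  refine mul_le_mul_of_nonneg_left (measureReal_mono fun ω hω => ?_) hε.le
  exact le_trans hω (abs_sqrt_sub_one_le (varRatio_nonneg hr ω))

/-- The t-statistic of a centered array is asymptotically standard Gaussian. -/
theorem tendsto_measureReal_lt_tStatistic (h : IsCenteredArray P s) (x : ℝ) :
    Tendsto (fun r : ℕ => P.real {ω | x < tStatistic fun i => s r i ω}) atTop
      (𝓝 ((gaussianReal 0 1).real (Set.Ioi x))) := by
  have hDmeas := h.measurable_varRatio
  have hD := h.tendstoInMeasure_sqrt_varRatio
  have hW := h.tendstoInDistribution_normalized_sum.continuous_comp_prodMk_of_tendstoInMeasure_const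
    (g := fun z : ℝ × ℝ => z.1 + -x * z.2) (by fun_prop) hD fun r => by fun_prop
  set W : ℕ → Ω → ℝ := fun r ω =>
    (√(rowVar P s r))⁻¹ * ∑ i, s r i ω + -x * √(varRatio P s r ω)
  have hWmeas : ∀ r, AEMeasurable (W r) P := hW.forall_aemeasurable
  have hlimW : Tendsto (fun r => P.real {ω | 0 < W r ω}) atTop
      (𝓝 ((gaussianReal 0 1).real (Set.Ioi x))) := by
    -- The limit variable is a Gaussian shifted by `-x`, which does not charge the boundary point
    -- `0`.
    have hfr : ((gaussianReal 0 1).map fun z : ℝ => id z + -x * 1) (frontier (Set.Ioi 0)) = 0 := by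
      rw [frontier_Ioi, Measure.map_apply (by fun_prop) (measurableSet_singleton 0)]
      have : (fun z : ℝ => id z + -x * 1) ⁻¹' {0} = {x} := by
        ext z; simp [← sub_eq_add_neg, sub_eq_zero]
      rw [this]
      exact (nullSingletonClass_gaussianReal one_ne_zero).measure_singleton x
    have key := ProbabilityMeasure.tendsto_measure_of_null_frontier_of_tendsto' hW.tendsto hfr
    have hI : (fun z : ℝ => id z + -x * 1) ⁻¹' Set.Ioi 0 = Set.Ioi x := by ext z; simp
    simp only [ProbabilityMeasure.coe_mk] at key
    rw [Measure.map_apply (by fun_prop) measurableSet_Ioi, hI] at key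
    have key2 := (ENNReal.tendsto_toReal (measure_ne_top _ _)).comp key
    refine key2.congr fun r => ?_
    exact congrArg ENNReal.toReal
      (Measure.map_apply_of_aemeasurable (hWmeas r) measurableSet_Ioi)
  rw [tendstoInMeasure_iff_measureReal_norm] at hD
  have hzero := hD 1 one_pos
  obtain ⟨v, hv, hvr⟩ := h.exists_mul_le_rowVar
  -- The two events can differ only where `varRatio` fails to be positive. There its square root is
  -- `0`, at distance `1` from the limit, so this set has vanishing probability.
  have hdiff : Tendsto (fun r : ℕ => P.real {ω | x < tStatistic fun i => s r i ω} -
      P.real {ω | 0 < W r ω}) atTop (𝓝 0) := by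
    refine squeeze_zero_norm' ?_ hzero
    filter_upwards [hvr, eventually_ge_atTop 1] with r hr hr1
    have hV : 0 < rowVar P s r :=
      lt_of_lt_of_le (mul_pos hv (by exact_mod_cast hr1)) hr
    have hsub : ∀ ω, ω ∉ {ω | (1 : ℝ) ≤ ‖√(varRatio P s r ω) - 1‖} →
        (x < tStatistic (fun i => s r i ω) ↔ 0 < W r ω) := by
      intro ω hω
      refine lt_tStatistic_iff hV ?_ x
      by_contra hc
      apply hω
      simp [Real.sqrt_eq_zero_of_nonpos (not_lt.1 hc)]
    rw [Real.norm_eq_abs, abs_sub_le_iff, sub_le_iff_le_add, sub_le_iff_le_add]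
    constructor
    · refine le_trans (measureReal_mono fun ω hω => ?_) (measureReal_union_le _ _)
      by_cases hm : ω ∈ {ω | (1 : ℝ) ≤ ‖√(varRatio P s r ω) - 1‖}
      · exact Or.inl hm
      · exact Or.inr ((hsub ω hm).1 hω)
    · refine le_trans (measureReal_mono fun ω hω => ?_) (measureReal_union_le _ _)
      by_cases hm : ω ∈ {ω | (1 : ℝ) ≤ ‖√(varRatio P s r ω) - 1‖}
      · exact Or.inl hm
      · exact Or.inr ((hsub ω hm).2 hω)
  simpa using hdiff.add hlimW

/-- The t-test is asymptotically of level `α` on centered arrays. -/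
theorem tendsto_measureReal_tTestPValue_lt (h : IsCenteredArray P s) {α : ℝ}
    (hα : α ∈ Set.Ioo (0 : ℝ) 1) :
    Tendsto (fun r : ℕ => P.real {ω | tTestPValue (fun i => s r i ω) < α}) atTop (𝓝 α) := by
  rw [tendsto_order]
  constructor
  · intro a ha
    -- A level `β` just below `α`: the Student tail at its Gaussian quantile `x` is eventually below
    -- `α`, so a t-statistic beyond `x` forces rejection. Three shards give the two degrees of
    -- freedom needed for monotone tails.
    obtain ⟨β, hβ1, hβ2⟩ := exists_between (max_lt ha hα.1)
    obtain ⟨x, hx⟩ := exists_gaussian_tail_eq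
      ⟨(le_max_right a 0).trans_lt hβ1, hβ2.trans hα.2⟩
    have h1 := h.tendsto_measureReal_lt_tStatistic x
    have h2 := tendsto_studentTail x
    rw [hx] at h1 h2
    filter_upwards [h1.eventually_const_lt ((le_max_left a 0).trans_lt hβ1),
      h2.eventually_lt_const hβ2, eventually_ge_atTop 3] with r hr1 hr2 hr3
    have hr3' : (3 : ℝ) ≤ r := by exact_mod_cast hr3
    refine hr1.trans_le (measureReal_mono fun ω hω => ?_)
    exact (antitone_studentTail (by linarith : (2 : ℝ) ≤ (r : ℝ) - 1) (le_of_lt hω)).trans_lt hr2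
  · intro a ha
    -- Now `β` lies just above `α`, and rejection forces the t-statistic beyond `x`.
    obtain ⟨β, hβ1, hβ2⟩ := exists_between (lt_min ha hα.2)
    obtain ⟨x, hx⟩ := exists_gaussian_tail_eq
      ⟨hα.1.trans hβ1, hβ2.trans_le (min_le_right a 1)⟩
    have h1 := h.tendsto_measureReal_lt_tStatistic x
    have h2 := tendsto_studentTail x
    rw [hx] at h1 h2
    filter_upwards [h1.eventually_lt_const (hβ2.trans_le (min_le_left a 1)),
      h2.eventually_const_lt hβ1, eventually_ge_atTop 3] with r hr1 hr2 hr3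
    have hr3' : (3 : ℝ) ≤ r := by exact_mod_cast hr3
    refine (measureReal_mono fun ω hω => ?_).trans_lt hr1
    by_contra hc
    have := antitone_studentTail (by linarith : (2 : ℝ) ≤ (r : ℝ) - 1) (not_lt.1 hc)
    exact lt_irrefl α (hr2.trans_le (this.trans (le_of_lt hω)))

end IsCenteredArray

/-! ### Grouping independent families -/

section Grouping

variable {Ω : Type*} [MeasurableSpace Ω] {P : Measure Ω} [IsProbabilityMeasure P]

/-- Disjoint blocks of an independent family are independent. -/
theorem iIndepFun_curry {ι : Type*} {κ : ι → Type*} {𝓧 : (i : ι) → κ i → Type*}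
    [∀ i j, MeasurableSpace (𝓧 i j)] {X : (i : ι) → (j : κ i) → Ω → 𝓧 i j}
    (mX : ∀ i j, Measurable (X i j))
    (h : iIndepFun (fun (a : (i : ι) × κ i) ω => X a.1 a.2 ω) P) :
    iIndepFun (fun i ω j => X i j ω) P := by
  have hprob : ∀ i j, IsProbabilityMeasure (P.map (X i j)) :=
    fun i j => Measure.isProbabilityMeasure_map (mX i j).aemeasurable
  have hblock : ∀ i, P.map (fun ω j => X i j ω) =
      Measure.infinitePi fun j => P.map (X i j) := fun i =>
    (iIndepFun_iff_map_fun_eq_infinitePi_map (mX i)).1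
      (h.precomp (g := fun j : κ i => (⟨i, j⟩ : (i : ι) × κ i)) sigma_mk_injective)
  have hcurry : (MeasurableEquiv.piCurry 𝓧) ∘ (fun ω (a : (i : ι) × κ i) => X a.1 a.2 ω) =
      fun ω i j => X i j ω := by
    ext; simp [Sigma.curry]
  rw [iIndepFun_iff_map_fun_eq_infinitePi_map (by fun_prop), ← hcurry,
    ← Measure.map_map (by fun_prop) (by fun_prop),
    (iIndepFun_iff_map_fun_eq_infinitePi_map (by fun_prop)).1 h]
  rw [Measure.infinitePi_map_piCurry fun i j => P.map (X i j)]
  simp_rw [hblock]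

/-- Pairing up two independent families that are independent of each other. -/
theorem iIndepFun_prodMk {ι : Type*} [Fintype ι] {β γ : ι → Type*}
    [∀ i, Countable (β i)] [∀ i, Countable (γ i)]
    [∀ i, MeasurableSpace (β i)] [∀ i, MeasurableSpace (γ i)]
    [∀ i, MeasurableSingletonClass (β i)] [∀ i, MeasurableSingletonClass (γ i)]
    {U : (i : ι) → Ω → β i} {W : (i : ι) → Ω → γ i}
    (mU : ∀ i, Measurable (U i)) (mW : ∀ i, Measurable (W i))
    (hU : iIndepFun U P) (hW : iIndepFun W P)
    (hUW : IndepFun (fun ω i => U i ω) (fun ω i => W i ω) P) :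
    iIndepFun (fun i ω => (U i ω, W i ω)) P := by
  have hprobU : ∀ i, IsProbabilityMeasure (P.map (U i)) :=
    fun i => Measure.isProbabilityMeasure_map (mU i).aemeasurable
  have hprobW : ∀ i, IsProbabilityMeasure (P.map (W i)) :=
    fun i => Measure.isProbabilityMeasure_map (mW i).aemeasurable
  have hi : ∀ i, P.map (fun ω => (U i ω, W i ω)) = (P.map (U i)).prod (P.map (W i)) := fun i =>
    (indepFun_iff_map_prod_eq_prod_map_map (mU i).aemeasurable (mW i).aemeasurable).1
      (hUW.comp (measurable_pi_apply i) (measurable_pi_apply i))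
  rw [iIndepFun_iff_map_fun_eq_pi_map fun i => ((mU i).prodMk (mW i)).aemeasurable]
  simp_rw [hi]
  refine Measure.ext_of_singleton fun x => ?_
  rw [Measure.pi_singleton, Measure.map_apply (by fun_prop) (measurableSet_singleton x)]
  have e : (fun ω i => (U i ω, W i ω)) ⁻¹' {x} =
      (fun ω i => U i ω) ⁻¹' {fun i => (x i).1} ∩ (fun ω i => W i ω) ⁻¹' {fun i => (x i).2} := by
    ext ω
    simp only [Set.mem_preimage, Set.mem_singleton_iff, Set.mem_inter_iff, funext_iff,
      Prod.ext_iff, forall_and]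
  rw [e, hUW.measure_inter_preimage_eq_mul _ _ (measurableSet_singleton _)
    (measurableSet_singleton _),
    ← Measure.map_apply (by fun_prop) (measurableSet_singleton _),
    ← Measure.map_apply (by fun_prop) (measurableSet_singleton _),
    (iIndepFun_iff_map_fun_eq_pi_map fun i => (mU i).aemeasurable).1 hU,
    (iIndepFun_iff_map_fun_eq_pi_map fun i => (mW i).aemeasurable).1 hW,
    Measure.pi_singleton, Measure.pi_singleton, ← Finset.prod_mul_distrib]
  refine Finset.prod_congr rfl fun i _ => ?_
  rw [← Measure.prod_prod, Set.singleton_prod_singleton]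

end Grouping

/-! ### Averaging over reorderings -/

instance instDiscreteMeasurableSpaceTokenSeq {V : Type*} : DiscreteMeasurableSpace (List V) :=
  ⟨fun _ => trivial⟩

instance instDiscreteMeasurableSpacePerm {k : ℕ} :
    DiscreteMeasurableSpace (Equiv.Perm (Fin k)) :=
  ⟨fun _ => trivial⟩

section Reordering

variable {α : Type*} {k : ℕ}

/-- The average of `Y` over all reorderings of `x`. -/
noncomputable def permAvg (Y : (Fin k → α) → ℝ) (x : Fin k → α) : ℝ :=
  (∑ σ : Equiv.Perm (Fin k), Y (x ∘ σ)) / (k.factorial : ℝ)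

/-- Twice the Euclidean norm of the values of `Y` at all reorderings of `x`. -/
noncomputable def permBound (Y : (Fin k → α) → ℝ) (x : Fin k → α) : ℝ :=
  2 * √(∑ σ : Equiv.Perm (Fin k), Y (x ∘ σ) ^ 2)

theorem permAvg_comp (Y : (Fin k → α) → ℝ) (x : Fin k → α) (τ : Equiv.Perm (Fin k)) :
    permAvg Y (x ∘ τ) = permAvg Y x := by
  unfold permAvg
  congr 1
  exact Fintype.sum_equiv (Equiv.mulLeft τ) _ _ fun σ => rfl

theorem abs_le_half_permBound (Y : (Fin k → α) → ℝ) (x : Fin k → α)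
    (σ : Equiv.Perm (Fin k)) : |Y (x ∘ σ)| ≤ permBound Y x / 2 := by
  rw [permBound, mul_div_cancel_left₀ _ two_ne_zero]
  refine Real.abs_le_sqrt ?_
  exact Finset.single_le_sum (f := fun σ : Equiv.Perm (Fin k) => Y (x ∘ σ) ^ 2)
    (fun _ _ => sq_nonneg _) (Finset.mem_univ σ)

theorem permBound_nonneg (Y : (Fin k → α) → ℝ) (x : Fin k → α) : 0 ≤ permBound Y x := by
  unfold permBound; positivity

/-- The bound involves neither the number of permutations nor their values, so tail estimates are
uniform in both. -/
theorem abs_sub_avg_le_permBound (Y : (Fin k → α) → ℝ) (x : Fin k → α) {m : ℕ}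
    (w : Fin m → Equiv.Perm (Fin k)) :
    |Y x - (∑ j, Y (x ∘ w j)) / m| ≤ permBound Y x := by
  have h1 : |Y x| ≤ permBound Y x / 2 := abs_le_half_permBound Y x 1
  have h2 : |(∑ j, Y (x ∘ w j)) / (m : ℝ)| ≤ permBound Y x / 2 := by
    rw [abs_div, Nat.abs_cast]
    refine div_le_of_le_mul₀ (Nat.cast_nonneg m) (by linarith [permBound_nonneg Y x]) ?_
    calc |∑ j, Y (x ∘ w j)| ≤ ∑ j, |Y (x ∘ w j)| := Finset.abs_sum_le_sum_abs _ _
      _ ≤ ∑ _j : Fin m, permBound Y x / 2 :=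
          Finset.sum_le_sum fun j _ => abs_le_half_permBound Y x (w j)
      _ = _ := by simp [mul_comm]
  calc _ ≤ |Y x| + |(∑ j, Y (x ∘ w j)) / (m : ℝ)| := abs_sub _ _
    _ ≤ _ := by linarith

variable [MeasurableSpace α] {μ : Measure (Fin k → α)} {Y : (Fin k → α) → ℝ}

/-- The law `μ` is invariant under reordering. -/
def IsExchangeable (μ : Measure (Fin k → α)) : Prop :=
  ∀ σ : Equiv.Perm (Fin k), MeasurePreserving (fun x : Fin k → α => x ∘ σ) μ μ

theorem IsExchangeable.memLp (hμ : IsExchangeable μ) (hY : MemLp Y 2 μ)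
    (σ : Equiv.Perm (Fin k)) : MemLp (fun x => Y (x ∘ σ)) 2 μ :=
  hY.comp_measurePreserving (hμ σ)

theorem IsExchangeable.integral_comp (hμ : IsExchangeable μ) (hY : MemLp Y 2 μ)
    (σ : Equiv.Perm (Fin k)) : ∫ x, Y (x ∘ σ) ∂μ = ∫ x, Y x ∂μ := by
  have h := integral_map (μ := μ) (hμ σ).aemeasurable (f := Y)
    (by rw [(hμ σ).map_eq]; exact hY.aestronglyMeasurable)
  rw [(hμ σ).map_eq] at h
  exact h.symm

theorem IsExchangeable.memLp_permAvg (hμ : IsExchangeable μ) (hY : MemLp Y 2 μ) :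
    MemLp (permAvg Y) 2 μ := by
  have : MemLp (fun x => ∑ σ : Equiv.Perm (Fin k), Y (x ∘ σ)) 2 μ :=
    memLp_finsetSum _ fun σ _ => hμ.memLp hY σ
  simpa only [permAvg, div_eq_mul_inv] using! this.mul_const ((k.factorial : ℝ)⁻¹)

/-- If reordering affects `Y` with positive probability, then `Y` differs from its average over
reorderings. -/
theorem IsExchangeable.integral_sub_permAvg_sq_pos (hμ : IsExchangeable μ) (hY : MemLp Y 2 μ)
    (hnd : ¬ ∀ᵐ x ∂μ, ∀ σ : Equiv.Perm (Fin k), Y (x ∘ σ) = Y x) :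
    0 < ∫ x, (Y x - permAvg Y x) ^ 2 ∂μ := by
  have h0 : 0 ≤ ∫ x, (Y x - permAvg Y x) ^ 2 ∂μ := integral_nonneg fun _ => sq_nonneg _
  refine lt_of_le_of_ne h0 fun hz => hnd ?_
  have hint : Integrable (fun x => (Y x - permAvg Y x) ^ 2) μ :=
    (hY.sub (hμ.memLp_permAvg hY)).integrable_sq
  have hae : ∀ᵐ x ∂μ, Y x = permAvg Y x := by
    filter_upwards [(integral_eq_zero_iff_of_nonneg (fun _ => sq_nonneg _) hint).1 hz.symm]
      with x hx
    exact sub_eq_zero.1 (pow_eq_zero_iff two_ne_zero |>.1 hx)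
  -- Exchangeability carries the null set along each of the finitely many permutations; since the
  -- average is invariant, `Y` is then constant on almost every orbit.
  have hσ : ∀ᵐ x ∂μ, ∀ σ : Equiv.Perm (Fin k), Y (x ∘ σ) = permAvg Y (x ∘ σ) :=
    ae_all_iff.2 fun σ => (hμ σ).quasiMeasurePreserving.ae hae
  filter_upwards [hae, hσ] with x hx hxσ σ
  rw [hxσ σ, permAvg_comp, hx]

theorem exists_integral_sqTail_le [IsProbabilityMeasure μ] {G : (Fin k → α) → ℝ}
    (hG : MemLp G 2 μ) {ε : ℝ} (hε : 0 < ε) :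
    ∃ M, ∫ x, sqTail M (G x) ∂μ ≤ ε := by
  have hlim : Tendsto (fun n : ℕ => ∫ x, sqTail n (G x) ∂μ) atTop (𝓝 (∫ _, (0 : ℝ) ∂μ)) := by
    refine tendsto_integral_of_dominated_convergence (fun x => G x ^ 2)
      (fun n => (integrable_sqTail hG n).aestronglyMeasurable) hG.integrable_sq
      (fun n => ae_of_all _ fun x => ?_) (ae_of_all _ fun x => ?_)
    · rw [Real.norm_of_nonneg (sqTail_nonneg _ _)]
      exact sqTail_le_sq _ _
    · refine tendsto_const_nhds.congr' ?_
      filter_upwards [tendsto_natCast_atTop_atTop.eventually_ge_atTop |G x|] with n hn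
      rw [sqTail, if_neg (not_lt.2 hn)]
  rw [integral_zero] at hlim
  obtain ⟨n, hn⟩ := (hlim.eventually_le_const hε).exists
  exact ⟨n, hn⟩

theorem sqTail_le_sqTail {M M' x y : ℝ} (hM : M' ≤ M) (hxy : |x| ≤ |y|) :
    sqTail M x ≤ sqTail M' y := by
  unfold sqTail
  split_ifs with h1 h2
  · exact sq_le_sq.2 hxy
  · exact absurd (hM.trans_lt (h1.trans_le hxy)) h2
  · positivity
  · exact le_rfl

variable [Countable α] [MeasurableSingletonClass α]

theorem IsExchangeable.memLp_permBound (hμ : IsExchangeable μ) (hY : MemLp Y 2 μ) :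
    MemLp (permBound Y) 2 μ := by
  rw [memLp_two_iff_integrable_sq Measurable.of_discrete.aestronglyMeasurable]
  have : Integrable (fun x => 4 * ∑ σ : Equiv.Perm (Fin k), Y (x ∘ σ) ^ 2) μ :=
    (integrable_finsetSum _ fun σ _ => (hμ.memLp hY σ).integrable_sq).const_mul 4
  refine this.congr (ae_of_all _ fun x => ?_)
  simp only [permBound, mul_pow]
  rw [Real.sq_sqrt (Finset.sum_nonneg fun _ _ => sq_nonneg _)]
  norm_num

/-! ### The statistic of a single shard -/

variable {Ω : Type*} [MeasurableSpace Ω] {P : Measure Ω} [IsProbabilityMeasure P]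
  {U : Ω → Fin k → α}

/-- Expectation over an independent uniform permutation. -/
theorem integral_uniform_perm (hU : MeasurePreserving U P μ)
    {w : Ω → Equiv.Perm (Fin k)} (hw : Measurable w)
    (hunif : ∀ σ, P.real {ω | w ω = σ} = 1 / (k.factorial : ℝ)) (hind : IndepFun U w P)
    {F : (Fin k → α) → Equiv.Perm (Fin k) → ℝ} (hF : ∀ σ, Integrable (fun x => F x σ) μ) :
    Integrable (fun ω => F (U ω) (w ω)) P ∧
      ∫ ω, F (U ω) (w ω) ∂P = (∑ σ, ∫ x, F x σ ∂μ) / (k.factorial : ℝ) := by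
  classical
  have hFU : ∀ σ, Integrable (fun ω => F (U ω) σ) P := fun σ =>
    hU.integrable_comp_of_integrable (hF σ)
  set ind : Equiv.Perm (Fin k) → Equiv.Perm (Fin k) → ℝ := fun σ τ => if τ = σ then 1 else 0
  -- Splitting by the value of the permutation turns the claim into a finite sum of products of
  -- independent factors.
  have hdecomp : (fun ω => F (U ω) (w ω)) = fun ω => ∑ σ, F (U ω) σ * ind σ (w ω) := by
    ext ω
    simp [ind]
  have hindσ : ∀ σ, IndepFun (fun ω => F (U ω) σ) (fun ω => ind σ (w ω)) P := fun σ =>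
    hind.comp (φ := fun x => F x σ) (ψ := ind σ) Measurable.of_discrete Measurable.of_discrete
  have hindint : ∀ σ, Integrable (fun ω => ind σ (w ω)) P := fun σ =>
    Integrable.of_bound (C := 1)
      ((Measurable.of_discrete (f := ind σ)).comp hw).aestronglyMeasurable
      (ae_of_all _ fun ω => by simp only [ind]; split_ifs <;> simp)
  have hterm : ∀ σ, Integrable (fun ω => F (U ω) σ * ind σ (w ω)) P := fun σ =>
    (hindσ σ).integrable_mul (hFU σ) (hindint σ)
  rw [hdecomp]
  refine ⟨integrable_finsetSum _ fun σ _ => hterm σ, ?_⟩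
  rw [integral_finsetSum _ fun σ _ => hterm σ, Finset.sum_div]
  refine Finset.sum_congr rfl fun σ _ => ?_
  rw [(hindσ σ).integral_fun_mul_eq_mul_integral (hFU σ).aestronglyMeasurable
    (hindint σ).aestronglyMeasurable]
  have h1 : ∫ ω, ind σ (w ω) ∂P = 1 / (k.factorial : ℝ) := by
    have hset : {ω | w ω = σ} = w ⁻¹' {σ} := rfl
    rw [← hunif σ, hset, ← integral_indicator_one (hw (measurableSet_singleton σ))]
    refine integral_congr_ae (ae_of_all _ fun ω => ?_)
    simp [ind, Set.indicator_apply]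
  have h2 : ∫ ω, F (U ω) σ ∂P = ∫ x, F x σ ∂μ := by
    rw [← hU.map_eq, integral_map hU.aemeasurable Measurable.of_discrete.aestronglyMeasurable]
  rw [h1, h2]
  ring

end Reordering

section ShardStatistic

variable {α : Type*} [Countable α] [MeasurableSpace α] [MeasurableSingletonClass α] {k m : ℕ}
  {Ω : Type*} [MeasurableSpace Ω]

/-- A randomly reordered sample: `U` has the exchangeable law `μ`, and each `w j` is uniform and
independent of `U`. -/
structure IsReordering (P : Measure Ω) (μ : Measure (Fin k → α)) (U : Ω → Fin k → α)
    (w : Fin m → Ω → Equiv.Perm (Fin k)) : Prop where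
  exch : IsExchangeable μ
  law : MeasurePreserving U P μ
  measurable : ∀ j, Measurable (w j)
  unif : ∀ j σ, P.real {ω | w j ω = σ} = 1 / (k.factorial : ℝ)
  indep : ∀ j, IndepFun U (w j) P

/-- The value of `Y` at the sample minus its average over the random reorderings. -/
noncomputable def reorderStat (Y : (Fin k → α) → ℝ) (U : Ω → Fin k → α)
    (w : Fin m → Ω → Equiv.Perm (Fin k)) (ω : Ω) : ℝ :=
  Y (U ω) - (∑ j, Y (U ω ∘ w j ω)) / m

namespace IsReordering

variable {P : Measure Ω} {μ : Measure (Fin k → α)}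
  {U : Ω → Fin k → α} {w : Fin m → Ω → Equiv.Perm (Fin k)} {Y : (Fin k → α) → ℝ}

theorem measurable_reorderStat (h : IsReordering P μ U w) : Measurable (reorderStat Y U w) := by
  have hj : ∀ j, Measurable fun ω => Y (U ω ∘ w j ω) := fun j =>
    (Measurable.of_discrete (f := fun z : (Fin k → α) × Equiv.Perm (Fin k) =>
      Y (z.1 ∘ z.2))).comp (h.law.measurable.prodMk (h.measurable j))
  have h0 : Measurable fun ω => Y (U ω) :=
    (Measurable.of_discrete (f := Y)).comp h.law.measurable
  exact h0.sub ((Finset.measurable_fun_sum _ fun j _ => hj j).div_const _)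

theorem memLp_reorderStat (h : IsReordering P μ U w) (hY : MemLp Y 2 μ) :
    MemLp (reorderStat Y U w) 2 P := by
  refine ((h.exch.memLp_permBound hY).comp_measurePreserving h.law).mono
    h.measurable_reorderStat.aestronglyMeasurable (ae_of_all _ fun ω => ?_)
  rw [Function.comp, Real.norm_of_nonneg (permBound_nonneg _ _)]
  exact abs_sub_avg_le_permBound Y (U ω) fun j => w j ω

/-- Two thresholds are allowed so that one `M` can later serve all shard sizes, each with its own
`M'`. -/
theorem integral_sqTail_reorderStat_le (h : IsReordering P μ U w) (hY : MemLp Y 2 μ)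
    {M M' : ℝ} (hM : M' ≤ M) :
    ∫ ω, sqTail M (reorderStat Y U w ω) ∂P ≤ ∫ x, sqTail M' (permBound Y x) ∂μ := by
  have hb := h.exch.memLp_permBound hY
  rw [← h.law.map_eq, integral_map h.law.aemeasurable
    Measurable.of_discrete.aestronglyMeasurable]
  refine integral_mono (integrable_sqTail (h.memLp_reorderStat hY) M)
    (h.law.integrable_comp_of_integrable (integrable_sqTail hb M')) fun ω => ?_
  refine sqTail_le_sqTail hM ?_
  rw [abs_of_nonneg (permBound_nonneg _ _)]
  exact abs_sub_avg_le_permBound Y (U ω) fun j => w j ω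

variable [IsProbabilityMeasure P]

/-- Pairing the reordering statistic with a function of the sample. -/
theorem integral_reorderStat_mul (h : IsReordering P μ U w) (hm : m ≠ 0) (hY : MemLp Y 2 μ)
    {f : (Fin k → α) → ℝ} (hf : MemLp f 2 μ) :
    ∫ ω, reorderStat Y U w ω * f (U ω) ∂P = ∫ x, (Y x - permAvg Y x) * f x ∂μ := by
  have hm' : (m : ℝ) ≠ 0 := Nat.cast_ne_zero.2 hm
  have hYf : Integrable (fun x => Y x * f x) μ := hY.integrable_mul hf
  have hσ : ∀ σ : Equiv.Perm (Fin k), Integrable (fun x => Y (x ∘ σ) * f x) μ := fun σ =>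
    (h.exch.memLp hY σ).integrable_mul hf
  have key := fun j => integral_uniform_perm h.law (h.measurable j) (h.unif j) (h.indep j)
    (F := fun x σ => Y (x ∘ σ) * f x) hσ
  have hYfU : Integrable (fun ω => Y (U ω) * f (U ω)) P := h.law.integrable_comp_of_integrable hYf
  have hsum : Integrable (fun ω => (∑ j, Y (U ω ∘ w j ω) * f (U ω)) / m) P :=
    (integrable_finsetSum _ fun j _ => (key j).1).div_const _
  have e1 : ∀ ω, reorderStat Y U w ω * f (U ω) =
      Y (U ω) * f (U ω) - (∑ j, Y (U ω ∘ w j ω) * f (U ω)) / m := by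
    intro ω
    rw [reorderStat, ← Finset.sum_mul]
    ring
  have e2 : ∀ x, (Y x - permAvg Y x) * f x =
      Y x * f x - (∑ σ : Equiv.Perm (Fin k), Y (x ∘ σ) * f x) / (k.factorial : ℝ) := by
    intro x
    rw [permAvg, ← Finset.sum_mul]
    ring
  have hYfU' : ∫ ω, Y (U ω) * f (U ω) ∂P = ∫ x, Y x * f x ∂μ := by
    rw [← h.law.map_eq, integral_map h.law.aemeasurable
      Measurable.of_discrete.aestronglyMeasurable]
  simp_rw [e1, e2]
  rw [integral_sub hYfU hsum,
    integral_sub hYf ((integrable_finsetSum _ fun σ _ => hσ σ).div_const _), integral_div,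
    integral_div, integral_finsetSum _ fun j _ => (key j).1, integral_finsetSum _ fun σ _ => hσ σ,
    hYfU', Finset.sum_congr rfl fun j _ => (key j).2]
  congr 1
  simp only [Finset.sum_const, Finset.card_univ, Fintype.card_fin, nsmul_eq_mul]
  field_simp

/-- Pairing with the constant `1` leaves the mean of `Y - permAvg Y`, and exchangeability gives all
reorderings the same mean. -/
theorem integral_reorderStat_eq_zero (h : IsReordering P μ U w) (hm : m ≠ 0)
    (hY : MemLp Y 2 μ) : ∫ ω, reorderStat Y U w ω ∂P = 0 := by
  have hprob : IsProbabilityMeasure μ := by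
    rw [← h.law.map_eq]
    exact Measure.isProbabilityMeasure_map h.law.aemeasurable
  have hk : (k.factorial : ℝ) ≠ 0 := Nat.cast_ne_zero.2 k.factorial_ne_zero
  have h1 := h.integral_reorderStat_mul hm hY (f := fun _ => 1) (memLp_const 1)
  simp only [mul_one] at h1
  have hi : ∀ σ : Equiv.Perm (Fin k), Integrable (fun x => Y (x ∘ σ)) μ := fun σ =>
    (h.exch.memLp hY σ).integrable (by norm_num)
  rw [h1, integral_sub (hY.integrable (by norm_num))
    ((h.exch.memLp_permAvg hY).integrable (by norm_num))]
  simp only [permAvg]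
  rw [integral_div, integral_finsetSum _ fun σ _ => hi σ,
    Finset.sum_congr rfl fun σ _ => h.exch.integral_comp hY σ]
  simp only [Finset.sum_const, Finset.card_univ, Fintype.card_perm, Fintype.card_fin,
    nsmul_eq_mul]
  field_simp
  ring

/-- The function `Y - permAvg Y` of the sample is the `L²` projection of the statistic onto
functions of the sample, and a projection does not increase the norm. The resulting lower bound is
free of `m`. -/
theorem integral_sub_permAvg_sq_le (h : IsReordering P μ U w) (hm : m ≠ 0) (hY : MemLp Y 2 μ) :
    ∫ x, (Y x - permAvg Y x) ^ 2 ∂μ ≤ ∫ ω, reorderStat Y U w ω ^ 2 ∂P := by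
  set D : (Fin k → α) → ℝ := fun x => Y x - permAvg Y x with hD
  have hDL : MemLp D 2 μ := hY.sub (h.exch.memLp_permAvg hY)
  have hDU : MemLp (fun ω => D (U ω)) 2 P := hDL.comp_measurePreserving h.law
  have hS := h.memLp_reorderStat hY
  have h1 := h.integral_reorderStat_mul hm hY hDL
  have h2 : ∫ ω, D (U ω) ^ 2 ∂P = ∫ x, D x ^ 2 ∂μ := by
    rw [← h.law.map_eq, integral_map h.law.aemeasurable
      Measurable.of_discrete.aestronglyMeasurable]
  have h3 : 0 ≤ ∫ ω, (reorderStat Y U w ω - D (U ω)) ^ 2 ∂P :=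
    integral_nonneg fun _ => sq_nonneg _
  have e : ∀ ω, (reorderStat Y U w ω - D (U ω)) ^ 2 =
      reorderStat Y U w ω ^ 2 - 2 * (reorderStat Y U w ω * D (U ω)) + D (U ω) ^ 2 := by
    intro ω; ring
  have hSD : Integrable (fun ω => 2 * (reorderStat Y U w ω * D (U ω))) P :=
    (hS.integrable_mul hDU).const_mul 2
  have hsub : Integrable
      (fun ω => reorderStat Y U w ω ^ 2 - 2 * (reorderStat Y U w ω * D (U ω))) P :=
    hS.integrable_sq.sub hSD
  simp_rw [e] at h3
  rw [integral_add hsub hDU.integrable_sq, integral_sub hS.integrable_sq hSD,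
    integral_const_mul, h1, h2] at h3
  have h4 : ∫ x, (Y x - permAvg Y x) * D x ∂μ = ∫ x, D x ^ 2 ∂μ := by
    simp only [hD, sq]
  rw [h4] at h3
  linarith

end IsReordering

end ShardStatistic

/-! ### The shard statistics of a fixed model -/

theorem shardSize_le {n r K : ℕ} (hn : n / r ≤ K) (i : ℕ) : shardSize n r i ≤ K + 1 := by
  unfold shardSize
  split_ifs <;> omega

theorem shardStart_add_shardSize_le {n r i i' : ℕ} (h : i < i') :
    shardStart n r i + shardSize n r i ≤ shardStart n r i' := by
  have h1 : shardStart n r (i + 1) = shardStart n r i + shardSize n r i := by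
    simp [shardStart, Finset.sum_range_succ]
  rw [← h1]
  exact Finset.sum_le_sum_of_subset (Finset.range_mono h)

theorem injective_shard_index (n r : ℕ) : Function.Injective
    fun a : (i : Fin r) × Fin (shardSize n r i) => shardStart n r a.1 + (a.2 : ℕ) := by
  rintro ⟨i, j⟩ ⟨i', j'⟩ h
  simp only at h
  have hj := j.isLt
  have hj' := j'.isLt
  rcases lt_trichotomy (i : ℕ) i' with hlt | heq | hgt
  · have := shardStart_add_shardSize_le (n := n) (r := r) hlt
    omega
  · obtain rfl := Fin.ext heq
    have : j = j' := Fin.ext (by omega)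
    rw [this]
  · have := shardStart_add_shardSize_le (n := n) (r := r) hgt
    omega

section FixedModel

variable {V Ω : Type*} [MeasurableSpace Ω] {P : Measure Ω} [IsProbabilityMeasure P]
  {X : ℕ → Ω → List V}

/-- The law of `k` independent examples. -/
noncomputable def exampleLaw (P : Measure Ω) (X : ℕ → Ω → List V) (k : ℕ) :
    Measure (Fin k → List V) :=
  Measure.pi fun _ => P.map (X 0)

theorem measurePreserving_examples (hX : ∀ i, Measurable (X i)) (hXindep : iIndepFun X P)
    (hXident : ∀ i, IdentDistrib (X i) (X 0) P P) {k : ℕ} {e : Fin k → ℕ}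
    (he : Function.Injective e) :
    MeasurePreserving (fun ω j => X (e j) ω) P (exampleLaw P X k) := by
  refine ⟨by fun_prop, ?_⟩
  rw [(iIndepFun_iff_map_fun_eq_pi_map fun j => (hX (e j)).aemeasurable).1 (hXindep.precomp he),
    exampleLaw]
  simp_rw [fun i => (hXident i).map_eq]

theorem measurePreserving_shard (hX : ∀ i, Measurable (X i)) (hXindep : iIndepFun X P)
    (hXident : ∀ i, IdentDistrib (X i) (X 0) P P) (n r : ℕ) (i : Fin r) :
    MeasurePreserving (fun ω => shard r (fun l : Fin n => X l ω) i) P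
      (exampleLaw P X (shardSize n r i)) :=
  measurePreserving_examples hX hXindep hXident
    (e := fun j : Fin (shardSize n r i) => shardStart n r i + (j : ℕ))
    fun _ _ h => Fin.ext (Nat.add_left_cancel h)

theorem iIndepFun_shard (hX : ∀ i, Measurable (X i)) (hXindep : iIndepFun X P) (n r : ℕ) :
    iIndepFun (fun (i : Fin r) ω => shard r (fun l : Fin n => X l ω) i) P :=
  iIndepFun_curry (X := fun (i : Fin r) (j : Fin (shardSize n r i)) =>
    X (shardStart n r i + j)) (fun _ _ => hX _) (hXindep.precomp (injective_shard_index n r))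

variable [Countable V]

theorem isExchangeable_exampleLaw (hX : ∀ i, Measurable (X i)) (hXindep : iIndepFun X P)
    (hXident : ∀ i, IdentDistrib (X i) (X 0) P P) (k : ℕ) :
    IsExchangeable (exampleLaw P X k) := by
  intro σ
  have h1 := measurePreserving_examples hX hXindep hXident (k := k) Fin.val_injective
  have h2 := measurePreserving_examples hX hXindep hXident (k := k)
    (Fin.val_injective.comp σ.injective)
  refine ⟨Measurable.of_discrete, ?_⟩
  conv_lhs => rw [← h1.map_eq]
  rw [Measure.map_map Measurable.of_discrete h1.measurable]
  exact h2.map_eq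

/-- For a fixed model, the shard statistics form a centered array. -/
theorem isCenteredArray_shardStat (hX : ∀ i, Measurable (X i)) (hXindep : iIndepFun X P)
    (hXident : ∀ i, IdentDistrib (X i) (X 0) P P)
    {n m : ℕ → ℕ} {K : ℕ} (hn : ∀ r, n r / r ≤ K) (hm : ∀ r, 1 ≤ m r)
    {π : (r : ℕ) → (i : Fin r) → Fin (m r) → Ω → Equiv.Perm (Fin (shardSize (n r) r i))}
    (hπ : ∀ r i j, Measurable (π r i j))
    (hπunif : ∀ r i j σ,
      P.real {ω | π r i j ω = σ} = 1 / (Nat.factorial (shardSize (n r) r i) : ℝ))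
    (hπindep : ∀ r, iIndepFun (fun (a : Fin r × Fin (m r)) => π r a.1 a.2) P)
    (hπdata : ∀ r, IndepFun (fun ω i => X i ω) (fun ω i j => π r i j ω) P)
    (q : List V → ℝ)
    (hmom : ∀ (r : ℕ) (i : Fin r),
      MemLp (fun ω => logLik q (shard r (fun l : Fin (n r) => X l ω) i)) 2 P)
    (hnondeg : ∀ᶠ r in atTop, ∀ i : Fin r,
      ¬ ∀ᵐ ω ∂P, ∀ σ : Equiv.Perm (Fin (shardSize (n r) r i)),
        logLik q (shard r (fun l : Fin (n r) => X l ω) i ∘ σ) =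
          logLik q (shard r (fun l : Fin (n r) => X l ω) i)) :
    IsCenteredArray P fun r i ω =>
      shardStat q (shard r (fun l : Fin (n r) => X l ω) i) fun j => π r i j ω := by
  have hprob : IsProbabilityMeasure (P.map (X 0)) :=
    Measure.isProbabilityMeasure_map (hX 0).aemeasurable
  have hprobk : ∀ k, IsProbabilityMeasure (exampleLaw P X k) := fun k => by
    unfold exampleLaw; infer_instance
  have hlaw := fun r (i : Fin r) => measurePreserving_shard hX hXindep hXident (n r) r i
  have hmeasShard : ∀ r (i : Fin r), Measurable fun x : ℕ → List V =>
      shard r (fun l : Fin (n r) => x l) i := fun r i =>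
    measurable_pi_lambda _ fun j => measurable_pi_apply _
  have hre : ∀ r (i : Fin r), IsReordering P (exampleLaw P X (shardSize (n r) r i))
      (fun ω => shard r (fun l : Fin (n r) => X l ω) i) (π r i) := fun r i =>
    { exch := isExchangeable_exampleLaw hX hXindep hXident _
      law := hlaw r i
      measurable := hπ r i
      unif := hπunif r i
      indep := fun j => (hπdata r).comp (hmeasShard r i)
        ((measurable_pi_apply j).comp (measurable_pi_apply i)) }
  have hY : ∀ r (i : Fin r), MemLp (logLik q) 2 (exampleLaw P X (shardSize (n r) r i)) := by
    intro r i
    rw [← (hlaw r i).map_eq]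
    exact (memLp_map_measure_iff Measurable.of_discrete.aestronglyMeasurable
      (hlaw r i).aemeasurable).2 (hmom r i)
  have hm0 : ∀ r, m r ≠ 0 := fun r => Nat.one_le_iff_ne_zero.1 (hm r)
  -- Sizes reach `K + 1`, because the first shards take one extra example.
  have hsize : ∀ r (i : Fin r), shardSize (n r) r i ∈ Finset.range (K + 2) := fun r i =>
    Finset.mem_range.2 (Nat.lt_succ_of_le (shardSize_le (hn r) i))
  refine
    { measurable := fun r i => (hre r i).measurable_reorderStat
      memLp := fun r i => (hre r i).memLp_reorderStat (hY r i)
      indep := fun r => ?_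
      mean := fun r i => (hre r i).integral_reorderStat_eq_zero (hm0 r) (hY r i)
      tail := fun ε hε => ?_
      var := ?_ }
  · have hπgroup : iIndepFun (fun (i : Fin r) ω j => π r i j ω) P :=
      iIndepFun_curry (X := π r) (hπ r)
        ((hπindep r).precomp (Equiv.sigmaEquivProd (Fin r) (Fin (m r))).injective)
    have hpair := iIndepFun_prodMk (fun i => (hlaw r i).measurable)
      (fun i => measurable_pi_lambda _ (hπ r i)) (iIndepFun_shard hX hXindep (n r) r) hπgroup
      ((hπdata r).comp (measurable_pi_lambda _ (hmeasShard r)) measurable_id)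
    exact hpair.comp (fun _ z => shardStat q z.1 z.2) fun _ => Measurable.of_discrete
  · have hM : ∀ k, ∃ M, MemLp (logLik q) 2 (exampleLaw P X k) →
        ∫ x, sqTail M (permBound (logLik q) x) ∂exampleLaw P X k ≤ ε := by
      intro k
      by_cases hk : MemLp (logLik q) 2 (exampleLaw P X k)
      · obtain ⟨M, hM⟩ := exists_integral_sqTail_le
          ((isExchangeable_exampleLaw hX hXindep hXident k).memLp_permBound hk) hε
        exact ⟨M, fun _ => hM⟩
      · exact ⟨0, fun h => absurd h hk⟩
    choose M hM using hM
    obtain ⟨B, hB⟩ := ((Finset.range (K + 2)).image M).exists_le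
    refine ⟨B, fun r i => ?_⟩
    exact ((hre r i).integral_sqTail_reorderStat_le (hY r i)
      (hB _ (Finset.mem_image_of_mem M (hsize r i)))).trans (hM _ (hY r i))
  · set D : ℕ → ℝ := fun k =>
      ∫ x, (logLik q x - permAvg (logLik q) x) ^ 2 ∂exampleLaw P X k with hD
    have hne : (Finset.range (K + 2)).Nonempty := ⟨0, Finset.mem_range.2 (by omega)⟩
    refine ⟨(Finset.range (K + 2)).inf' hne fun k => if 0 < D k then D k else 1, ?_, ?_⟩
    · rw [gt_iff_lt, Finset.lt_inf'_iff]
      intro k _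
      split_ifs with h
      · exact h
      · exact one_pos
    · filter_upwards [hnondeg] with r hr i
      have hpos : 0 < D (shardSize (n r) r i) := by
        refine (isExchangeable_exampleLaw hX hXindep hXident _).integral_sub_permAvg_sq_pos
          (hY r i) fun hae => hr i ?_
        exact (hlaw r i).quasiMeasurePreserving.ae hae
      refine le_trans (Finset.inf'_le _ (hsize r i)) ?_
      rw [if_pos hpos]
      exact (hre r i).integral_sub_permAvg_sq_le (hm0 r) (hY r i)

end FixedModel

/-! ### Conditioning on the model -/

section Conditioning

variable {Θ E F Ω : Type*} [MeasurableSpace Θ] [MeasurableSpace E] [MeasurableSpace F]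
  [MeasurableSpace Ω] {P : Measure Ω} [IsProbabilityMeasure P] {θ : Ω → Θ} {U : Ω → E} {W : Ω → F}

/-- Both hypotheses together make the joint law a triple product, which is then reassociated. -/
theorem indepFun_prodMk_right (hθ : Measurable θ) (hU : Measurable U) (hW : Measurable W)
    (h1 : IndepFun θ U P) (h2 : IndepFun (fun ω => (θ ω, U ω)) W P) :
    IndepFun θ (fun ω => (U ω, W ω)) P := by
  have p1 := Measure.isProbabilityMeasure_map (μ := P) hθ.aemeasurable
  have p2 := Measure.isProbabilityMeasure_map (μ := P) hU.aemeasurable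
  have p3 := Measure.isProbabilityMeasure_map (μ := P) hW.aemeasurable
  have hUW : IndepFun U W P := h2.comp measurable_snd measurable_id
  rw [indepFun_iff_map_prod_eq_prod_map_map hθ.aemeasurable (hU.prodMk hW).aemeasurable,
    (indepFun_iff_map_prod_eq_prod_map_map hU.aemeasurable hW.aemeasurable).1 hUW,
    ← (measurePreserving_prodAssoc (P.map θ) (P.map U) (P.map W)).map_eq,
    ← (indepFun_iff_map_prod_eq_prod_map_map hθ.aemeasurable hU.aemeasurable).1 h1,
    ← (indepFun_iff_map_prod_eq_prod_map_map (hθ.prodMk hU).aemeasurable hW.aemeasurable).1 h2,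
    Measure.map_map (by fun_prop) (by fun_prop)]
  rfl

/-- Tonelli for the product law; this freezes the model without conditional distributions. -/
theorem measure_eq_lintegral_of_indepFun (hθ : Measurable θ) (hU : Measurable U)
    (h : IndepFun θ U P) {A : Set (Θ × E)} (hA : MeasurableSet A) :
    P {ω | (θ ω, U ω) ∈ A} = ∫⁻ ϑ, P {ω | (ϑ, U ω) ∈ A} ∂P.map θ := by
  have p2 := Measure.isProbabilityMeasure_map (μ := P) hU.aemeasurable
  have e : P {ω | (θ ω, U ω) ∈ A} = (P.map fun ω => (θ ω, U ω)) A :=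
    (Measure.map_apply (hθ.prodMk hU) hA).symm
  rw [e, (indepFun_iff_map_prod_eq_prod_map_map hθ.aemeasurable hU.aemeasurable).1 h,
    Measure.prod_apply hA]
  refine lintegral_congr fun ϑ => ?_
  rw [Measure.map_apply hU (measurable_prodMk_left hA)]
  rfl

theorem ae_memLp_of_indepFun (hθ : Measurable θ) (hU : Measurable U)
    (h : IndepFun θ U P) {g : Θ × E → ℝ} (hg : Measurable g)
    (hL : MemLp (fun ω => g (θ ω, U ω)) 2 P) :
    ∀ᵐ ϑ ∂P.map θ, MemLp (fun ω => g (ϑ, U ω)) 2 P := by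
  have p1 := Measure.isProbabilityMeasure_map (μ := P) hθ.aemeasurable
  have p2 := Measure.isProbabilityMeasure_map (μ := P) hU.aemeasurable
  have h1 : MemLp g 2 (P.map fun ω => (θ ω, U ω)) :=
    (memLp_map_measure_iff hg.aestronglyMeasurable (hθ.prodMk hU).aemeasurable).2 hL
  rw [(indepFun_iff_map_prod_eq_prod_map_map hθ.aemeasurable hU.aemeasurable).1 h] at h1
  filter_upwards [h1.integrable_sq.prod_right_ae] with ϑ hϑ
  have hgϑ : Measurable fun u => g (ϑ, u) := hg.comp measurable_prodMk_left
  exact (memLp_map_measure_iff hgϑ.aestronglyMeasurable hU.aemeasurable).1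
    ((memLp_two_iff_integrable_sq hgϑ.aestronglyMeasurable).2 hϑ)

end Conditioning

theorem measurable_logLik {V Θ : Type*} [MeasurableSpace Θ] {p : Θ → List V → ℝ}
    (hp : ∀ s, Measurable fun ϑ => p ϑ s) {k : ℕ} (x : Fin k → List V) :
    Measurable fun ϑ => logLik (p ϑ) x :=
  Real.measurable_log.comp (hp _)

/-- The p-value is a monotone, hence measurable, function of the t-statistic once `r ≥ 3`. -/
theorem measurable_shardedPValue {V Θ : Type*} [MeasurableSpace Θ] {p : Θ → List V → ℝ}
    (hp : ∀ s, Measurable fun ϑ => p ϑ s) {n r m : ℕ} (hr : 3 ≤ r) (x : Fin n → List V)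
    (π : (i : Fin r) → Fin m → Equiv.Perm (Fin (shardSize n r i))) :
    Measurable fun ϑ => shardedPValue (p ϑ) x π := by
  have hr' : (3 : ℝ) ≤ r := by exact_mod_cast hr
  refine (antitone_studentTail (by linarith : (2 : ℝ) ≤ (r : ℝ) - 1)).measurable.comp
    (measurable_tStatistic.comp (measurable_pi_lambda _ fun i => ?_))
  exact (measurable_logLik hp _).sub
    ((Finset.measurable_fun_sum _ fun j _ => measurable_logLik hp _).div_const _)

end ShardedTest
-- Main theorem: averaging over the model
open ShardedTest
/-- Asymptotic validity of the sharded rank comparison test, as the number `r` of shards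
tends to infinity. The test with `r` shards is run on the first `n r` terms of an i.i.d.
sequence of examples `X 0, X 1, …`, with `m r` permutations per shard. -/
theorem mainTheorem2
    {V Θ Ω : Type*} [Countable V] [MeasurableSpace Θ] [MeasurableSpace Ω]
    (P : Measure Ω) [IsProbabilityMeasure P]
    -- `p ϑ s` is the probability of the token sequence `s` under the model `ϑ`
    (p : Θ → List V → ℝ) (hp : ∀ s, Measurable fun ϑ => p ϑ s)
    (θ : Ω → Θ) (hθ : Measurable θ)
    -- i.i.d. examples
    (X : ℕ → Ω → List V) (hX : ∀ i, Measurable (X i))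
    (hXindep : iIndepFun X P) (hXident : ∀ i, IdentDistrib (X i) (X 0) P P)
    -- the null hypothesis
    (hH0 : IndepFun θ (fun ω i => X i ω) P)
    -- number of examples and number of permutations per shard, for `r` shards
    (n m : ℕ → ℕ) (K : ℕ) (hn : ∀ r, n r / r ≤ K) (hm : ∀ r, 1 ≤ m r)
    -- independent uniform permutations, independent of the model and the data
    (π : (r : ℕ) → (i : Fin r) → Fin (m r) → Ω → Equiv.Perm (Fin (shardSize (n r) r i)))
    (hπ : ∀ r i j, Measurable (π r i j))
    (hπunif : ∀ r i j σ,
      P.real {ω | π r i j ω = σ} = 1 / (Nat.factorial (shardSize (n r) r i) : ℝ))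
    (hπindep : ∀ r, iIndepFun (fun (a : Fin r × Fin (m r)) => π r a.1 a.2) P)
    (hπdata : ∀ r, IndepFun (fun ω => (θ ω, fun i => X i ω)) (fun ω i j => π r i j ω) P)
    -- finite second moments of the shard log-likelihoods
    (hpos : ∀ (r : ℕ) (i : Fin r), ∀ᵐ ω ∂P,
      0 < p (θ ω) (seq (shard r (fun l : Fin (n r) => X l ω) i)))
    (hmom : ∀ (r : ℕ) (i : Fin r),
      MemLp (fun ω => logLik (p (θ ω)) (shard r (fun l : Fin (n r) => X l ω) i)) 2 P)
    -- non-degeneracy: for almost every model, the log-likelihood of a shard is not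
    -- almost surely unaffected by reordering the shard
    (hnondeg : ∀ᶠ r in atTop, ∀ i : Fin r, ∀ᵐ ϑ ∂(P.map θ),
      ¬ ∀ᵐ ω ∂P, ∀ σ : Equiv.Perm (Fin (shardSize (n r) r i)),
        logLik (p ϑ) (shard r (fun l : Fin (n r) => X l ω) i ∘ σ) =
          logLik (p ϑ) (shard r (fun l : Fin (n r) => X l ω) i))
    (α : ℝ) (hα : α ∈ Set.Ioo (0 : ℝ) 1) :
    Tendsto (fun r : ℕ =>
        |P.real {ω | shardedPValue (p (θ ω)) (fun l : Fin (n r) => X l ω)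
            (fun i j => π r i j ω) < α} - α|)
      atTop (𝓝 0) := by
  have hXm : Measurable fun ω i => X i ω := measurable_pi_lambda _ hX
  have hrestr : ∀ r, Measurable fun x : ℕ → List V => fun l : Fin (n r) => x l := fun r =>
    measurable_pi_lambda _ fun l => measurable_pi_apply _
  have hπm : ∀ r, Measurable fun ω i j => π r i j ω := fun r =>
    measurable_pi_lambda _ fun i => measurable_pi_lambda _ fun j => hπ r i j
  have hUm : ∀ r, Measurable fun ω =>
      ((fun l : Fin (n r) => X l ω), fun (i : Fin r) j => π r i j ω) := fun r =>
    ((hrestr r).comp hXm).prodMk (hπm r)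
  have hXπ : ∀ r, IndepFun (fun ω i => X i ω) (fun ω i j => π r i j ω) P := fun r =>
    (hπdata r).comp measurable_snd measurable_id
  have hmomϑ : ∀ᵐ ϑ ∂P.map θ, ∀ (r : ℕ) (i : Fin r),
      MemLp (fun ω => logLik (p ϑ) (shard r (fun l : Fin (n r) => X l ω) i)) 2 P := by
    refine ae_all_iff.2 fun r => ae_all_iff.2 fun i => ?_
    have hsh : Measurable fun x : ℕ → List V => shard r (fun l : Fin (n r) => x l) i :=
      measurable_pi_lambda _ fun j => measurable_pi_apply _
    exact ae_memLp_of_indepFun (U := fun ω => shard r (fun l : Fin (n r) => X l ω) i)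
      hθ (hsh.comp hXm) (hH0.comp measurable_id hsh)
      (g := fun z : Θ × (Fin (shardSize (n r) r i) → List V) => logLik (p z.1) z.2)
      (measurable_from_prod_countable_left fun x => measurable_logLik hp x) (hmom r i)
  have hndϑ : ∀ᵐ ϑ ∂P.map θ, ∀ᶠ r in atTop, ∀ i : Fin r,
      ¬ ∀ᵐ ω ∂P, ∀ σ : Equiv.Perm (Fin (shardSize (n r) r i)),
        logLik (p ϑ) (shard r (fun l : Fin (n r) => X l ω) i ∘ σ) =
          logLik (p ϑ) (shard r (fun l : Fin (n r) => X l ω) i) := by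
    -- The threshold `r₀` does not depend on the model, so countably many null sets of models can be
    -- discarded at once.
    obtain ⟨r₀, hr₀⟩ := eventually_atTop.1 hnondeg
    have : ∀ᵐ ϑ ∂P.map θ, ∀ r, r₀ ≤ r → ∀ i : Fin r,
        ¬ ∀ᵐ ω ∂P, ∀ σ : Equiv.Perm (Fin (shardSize (n r) r i)),
          logLik (p ϑ) (shard r (fun l : Fin (n r) => X l ω) i ∘ σ) =
            logLik (p ϑ) (shard r (fun l : Fin (n r) => X l ω) i) := by
      refine ae_all_iff.2 fun r => ?_
      by_cases hr : r₀ ≤ r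
      · filter_upwards [ae_all_iff.2 (hr₀ r hr)] with ϑ hϑ _ using hϑ
      · exact ae_of_all _ fun ϑ h => absurd h hr
    filter_upwards [this] with ϑ hϑ
    exact eventually_atTop.2 ⟨r₀, hϑ⟩
  have hfixed : ∀ᵐ ϑ ∂P.map θ, Tendsto (fun r : ℕ =>
      P {ω | shardedPValue (p ϑ) (fun l : Fin (n r) => X l ω) (fun i j => π r i j ω) < α})
      atTop (𝓝 (ENNReal.ofReal α)) := by
    filter_upwards [hmomϑ, hndϑ] with ϑ h1 h2
    have h3 := (isCenteredArray_shardStat hX hXindep hXident hn hm hπ hπunif hπindep hXπ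
      (p ϑ) h1 h2).tendsto_measureReal_tTestPValue_lt hα
    refine ((ENNReal.continuous_ofReal.tendsto α).comp h3).congr fun r => ?_
    exact ofReal_measureReal (measure_ne_top _ _)
  -- Data and permutations take countably many values, so joint measurability follows from
  -- measurability in the model for each value.
  have hA : ∀ r, 3 ≤ r → MeasurableSet {z : Θ × ((Fin (n r) → List V) ×
      ((i : Fin r) → Fin (m r) → Equiv.Perm (Fin (shardSize (n r) r i)))) |
      shardedPValue (p z.1) z.2.1 z.2.2 < α} := fun r hr =>
    measurableSet_lt (measurable_from_prod_countable_left fun y =>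
      measurable_shardedPValue hp hr y.1 y.2) measurable_const
  have hdis : ∀ r, 3 ≤ r →
      P {ω | shardedPValue (p (θ ω)) (fun l : Fin (n r) => X l ω) (fun i j => π r i j ω) < α} =
        ∫⁻ ϑ, P {ω | shardedPValue (p ϑ) (fun l : Fin (n r) => X l ω)
          (fun i j => π r i j ω) < α} ∂P.map θ := by
    intro r hr
    have hind : IndepFun θ (fun ω => ((fun l : Fin (n r) => X l ω), fun i j => π r i j ω)) P :=
      indepFun_prodMk_right hθ ((hrestr r).comp hXm) (hπm r) (hH0.comp measurable_id (hrestr r))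
        ((hπdata r).comp (measurable_id.prodMap (hrestr r)) measurable_id)
    exact measure_eq_lintegral_of_indepFun hθ (hUm r) hind (hA r hr)
  have hprobθ := Measure.isProbabilityMeasure_map (μ := P) hθ.aemeasurable
  have hlim : Tendsto (fun r : ℕ => P {ω | shardedPValue (p (θ ω))
      (fun l : Fin (n r) => X l ω) (fun i j => π r i j ω) < α}) atTop
      (𝓝 (ENNReal.ofReal α)) := by
    have hD : Tendsto (fun r : ℕ => ∫⁻ ϑ, P {ω | shardedPValue (p ϑ)
        (fun l : Fin (n r) => X l ω) (fun i j => π r i j ω) < α} ∂P.map θ) atTop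
        (𝓝 (∫⁻ _, ENNReal.ofReal α ∂P.map θ)) := by
      refine tendsto_lintegral_filter_of_dominated_convergence (fun _ => 1) ?_
        (Eventually.of_forall fun r => ae_of_all _ fun ϑ => prob_le_one) (by simp) hfixed
      filter_upwards [eventually_ge_atTop 3] with r hr
      have hprobU := Measure.isProbabilityMeasure_map (μ := P) (hUm r).aemeasurable
      have hmeas := measurable_measure_prodMk_left (ν := P.map fun ω =>
        ((fun l : Fin (n r) => X l ω), fun (i : Fin r) j => π r i j ω)) (hA r hr)
      have e : ∀ ϑ, (P.map fun ω => ((fun l : Fin (n r) => X l ω), fun (i : Fin r) j => π r i j ω))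
          (Prod.mk ϑ ⁻¹' {z | shardedPValue (p z.1) z.2.1 z.2.2 < α}) =
          P {ω | shardedPValue (p ϑ) (fun l : Fin (n r) => X l ω) (fun i j => π r i j ω) < α} :=
        fun ϑ => Measure.map_apply (hUm r) (measurable_prodMk_left (hA r hr))
      simp_rw [e] at hmeas
      exact hmeas
    rw [lintegral_const, measure_univ, mul_one] at hD
    refine hD.congr' ?_
    filter_upwards [eventually_ge_atTop 3] with r hr using (hdis r hr).symm
  have hreal := (ENNReal.tendsto_toReal ENNReal.ofReal_ne_top).comp hlim
  rw [ENNReal.toReal_ofReal hα.1.le] at hreal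
  have := (hreal.sub_const α).abs
  rwa [sub_self, abs_zero] at this
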